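/- **Setting.** Let $E\to M$ be an exact Courant algebroid over a smooth manifold, with anchor $p:E\to TM$, pairing $\langle\cdot,\cdot\rangle$ and bracket $[\![\cdot,\cdot]\!]$; let $p^*:T^*M\to E$ be given by $\langle p^*\alpha,e\rangle=\alpha(p(e))$. Let $G$ be a compact connected Lie group with Lie algebra $\mathfrak g$, acting smoothly on $M$, and let $(\mathcal A,\chi)$ be an isotropic $G$-lifted action on $E$: a smooth action $\mathcal A$ of $G$ on $E$ by Courant algebroid automorphisms covering the action on $M$, and a bracket-preserving linear map $\chi:\mathfrak g\to\Gamma(E)$ such that the infinitesimal action of $u\in\mathfrak g$ on $\Gamma(E)$ is $[\![\chi(u),\cdot]\!]$ and $\langle\chi(u),\chi(u)\rangle=0$. Let $j:N\to M$ be a $G$-invariant submanifold on which $G$ acts freely, and let $q:N\to M_{red}=N/G$ be the quotient map onto the quotient manifold. For $x\in N$ put $$K_x=\{\chi(u)(x)\mid u\in\mathfrak g\}+p^*(\mathrm{Ann}\,T_xN)\subset E_x,\qquad E_{red}=(K^\perp/K)/G .$$ Write $[e]\in E_{red}|_{q(x)}$ for the class of $e\in K_x^\perp$. The pairing and the anchor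 of $E$ induce $\langle[e],[e']\rangle_{red}=\langle e,e'\rangle$ and $p_{red}[e]=dq_x(p(e))$, and $p_{red}^*:T^*M_{red}\to E_{red}$ is given by $\langle p_{red}^*\eta,\cdot\rangle_{red}=\eta\circ p_{red}$. Let $L\subset E$ be a $G$-invariant Dirac structure and $$L_{red}=\Big(\frac{L|_N\cap K^\perp+K}{K}\Big)\Big/G\subset E_{red}.$$ Let $\nabla:TM\to E$ be an $(\mathcal A,\chi,N)$-admissible splitting: a smooth isotropic splitting of $p$, $G$-invariant, and such that the one-forms $\xi_\nabla(u)$ defined by $\chi(u)=\nabla p(\chi(u))+p^*\xi_\nabla(u)$ satisfy $j^*\xi_\nabla(u)=0$ for all $u\in\mathfrak g$. Define $\nabla_{red}:TM_{red}\to E_{red}$ by $\nabla_{red}\,dq_x(X)=[\nabla X]$ for $X\in T_xN$, and $$\mathfrak Bj(L_x)=\{X+dj_x^*\beta\in T_xN\oplus T_x^*N\mid \beta\in T_x^*M,\ \nabla X+p^*\beta\in L_x\}.$$ **Proposition.** Let $x\in N$. 1. For all $Y\in T_{q(x)}M_{red}$ and $\eta\in T^*_{q(x)}M_{red}$, $$\nabla_{red}Y+p_{red}^*\eta\in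 L_{red}|_{q(x)}\iff\exists X\in T_xN:\ dq_x(X)=Y\ \text{ and }\ X+dq_x^*\eta\in\mathfrak Bj(L_x).$$ 2. The map $Y+\eta\mapsto\nabla_{red}Y+p_{red}^*\eta$ is a bijection $T_{q(x)}M_{red}\oplus T^*_{q(x)}M_{red}\to E_{red}|_{q(x)}$, and it carries the forward image under $q$ of the backward image of $L$ under $j$, $$\{dq_x(X)+\eta\mid X+dq_x^*\eta\in\mathfrak Bj(L_x)\},$$ onto $L_{red}|_{q(x)}$. -/

import Mathlib

open Bundle Manifold
open scoped ContDiff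

noncomputable section

namespace DiracReduction

/-! ### Exact Courant algebroids -/

section Courant

variable (EM : Type*) [NormedAddCommGroup EM] [NormedSpace ℝ EM]
  (M : Type*) [TopologicalSpace M] [ChartedSpace EM M] [IsManifold 𝓘(ℝ, EM) ∞ M]
  (F : Type*) [NormedAddCommGroup F] [NormedSpace ℝ F]
  (E : M → Type*) [TopologicalSpace (TotalSpace F E)] [∀ x, TopologicalSpace (E x)]
  [∀ x, AddCommGroup (E x)] [∀ x, Module ℝ (E x)] [FiberBundle F E] [VectorBundle ℝ F E]

/-- The cotangent space `T_x^* M`. -/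
abbrev Cotangent {EM : Type*} [NormedAddCommGroup EM] [NormedSpace ℝ EM]
    {M : Type*} [TopologicalSpace M] [ChartedSpace EM M] (x : M) : Type _ :=
  Module.Dual ℝ (TangentSpace 𝓘(ℝ, EM) x)

/-- The derivative `v f` of a real function `f` along a tangent vector `v` at `x`. -/
def dirDeriv {EM : Type*} [NormedAddCommGroup EM] [NormedSpace ℝ EM]
    {M : Type*} [TopologicalSpace M] [ChartedSpace EM M]
    (f : M → ℝ) (x : M) (v : TangentSpace 𝓘(ℝ, EM) x) : ℝ :=
  NormedSpace.fromTangentSpace (f x) (mfderiv 𝓘(ℝ, EM) 𝓘(ℝ, ℝ) f x v)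

/-- An exact Courant algebroid structure on the smooth vector bundle `E → M`: an anchor
`p : E → TM`, a fibrewise nondegenerate symmetric pairing and a (non-skew, "Dorfman") bracket
on smooth sections, such that `0 → T^*M → E → TM → 0` is exact. -/
structure ExactCourantAlgebroid where
  anchor : ∀ x, E x →ₗ[ℝ] TangentSpace 𝓘(ℝ, EM) x
  pairing : ∀ x, LinearMap.BilinForm ℝ (E x)
  bracket : Cₛ^∞⟮𝓘(ℝ, EM); F, E⟯ →ₗ[ℝ] Cₛ^∞⟮𝓘(ℝ, EM); F, E⟯ →ₗ[ℝ] Cₛ^∞⟮𝓘(ℝ, EM); F, E⟯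
  /-- the anchor is a smooth bundle map -/
  smooth_anchor : ∀ e : Cₛ^∞⟮𝓘(ℝ, EM); F, E⟯,
    ContMDiff 𝓘(ℝ, EM) (𝓘(ℝ, EM).prod 𝓘(ℝ, EM)) ∞
      (fun x => (⟨x, anchor x (e x)⟩ : TangentBundle 𝓘(ℝ, EM) M))
  /-- the pairing is smooth -/
  smooth_pairing : ∀ e₁ e₂ : Cₛ^∞⟮𝓘(ℝ, EM); F, E⟯,
    ContMDiff 𝓘(ℝ, EM) 𝓘(ℝ, ℝ) ∞ (fun x => pairing x (e₁ x) (e₂ x))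
  pairing_symm : ∀ x e₁ e₂, pairing x e₁ e₂ = pairing x e₂ e₁
  pairing_nondegenerate : ∀ x, (pairing x).Nondegenerate
  /-- Jacobi (Leibniz) identity -/
  jacobi : ∀ e₁ e₂ e₃, bracket e₁ (bracket e₂ e₃) =
    bracket (bracket e₁ e₂) e₃ + bracket e₂ (bracket e₁ e₃)
  /-- `p [e₁, e₂] = [p e₁, p e₂]` -/
  anchor_bracket : ∀ e₁ e₂ x, anchor x (bracket e₁ e₂ x) =
    VectorField.mlieBracket 𝓘(ℝ, EM) (fun y => anchor y (e₁ y)) (fun y => anchor y (e₂ y)) x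
  /-- `[e₁, f e₂] = f [e₁, e₂] + (p(e₁) f) e₂` -/
  leibniz : ∀ (e₁ e₂ e₃ : Cₛ^∞⟮𝓘(ℝ, EM); F, E⟯) (f : M → ℝ),
    ContMDiff 𝓘(ℝ, EM) 𝓘(ℝ, ℝ) ∞ f → (∀ x, e₃ x = f x • e₂ x) →
      ∀ x, bracket e₁ e₃ x =
        f x • bracket e₁ e₂ x + dirDeriv f x (anchor x (e₁ x)) • e₂ x
  /-- `p(e₁) ⟨e₂, e₃⟩ = ⟨[e₁, e₂], e₃⟩ + ⟨e₂, [e₁, e₃]⟩` -/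
  pairing_invariant : ∀ e₁ e₂ e₃ x,
    dirDeriv (fun y => pairing y (e₂ y) (e₃ y)) x (anchor x (e₁ x)) =
      pairing x (bracket e₁ e₂ x) (e₃ x) + pairing x (e₂ x) (bracket e₁ e₃ x)
  /-- `[e, e] = ½ p^* d⟨e, e⟩` -/
  bracket_self : ∀ (e e' : Cₛ^∞⟮𝓘(ℝ, EM); F, E⟯) (x : M),
    2 * pairing x (bracket e e x) (e' x) =
      dirDeriv (fun y => pairing y (e y) (e y)) x (anchor x (e' x))
  anchor_surjective : ∀ x, Function.Surjective (anchor x)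
  /-- `ker p = im p^*`, where `p^* α` is the element with `⟨p^* α, e⟩ = α (p e)` -/
  exact_middle : ∀ x e, anchor x e = 0 ↔
    ∃ α : Cotangent (EM := EM) x, ∀ e', pairing x e e' = α (anchor x e')

end Courant

section Courant2

variable {EM : Type*} [NormedAddCommGroup EM] [NormedSpace ℝ EM]
  {M : Type*} [TopologicalSpace M] [ChartedSpace EM M] [IsManifold 𝓘(ℝ, EM) ∞ M]
  {F : Type*} [NormedAddCommGroup F] [NormedSpace ℝ F]
  {E : M → Type*} [TopologicalSpace (TotalSpace F E)] [∀ x, TopologicalSpace (E x)]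
  [∀ x, AddCommGroup (E x)] [∀ x, Module ℝ (E x)] [FiberBundle F E] [VectorBundle ℝ F E]

variable (F) in
theorem finiteDimensional_fibre [FiniteDimensional ℝ F] (x : M) : FiniteDimensional ℝ (E x) :=
  ((trivializationAt F E x).continuousLinearEquivAt ℝ x
    (FiberBundle.mem_baseSet_trivializationAt' x)).toLinearEquiv.symm.finiteDimensional

variable [FiniteDimensional ℝ F] (C : ExactCourantAlgebroid EM M F E)

/-- `p^* : T_x^*M → E_x`, the transpose of the anchor after identifying `E ≅ E^*` through the
pairing: `⟨p^* α, e⟩ = α (p e)`. -/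
def coanchor (x : M) : Cotangent (EM := EM) x →ₗ[ℝ] E x :=
  letI := finiteDimensional_fibre F (E := E) x
  ((C.pairing x).toDual (C.pairing_nondegenerate x)).symm.toLinearMap ∘ₗ (C.anchor x).dualMap

theorem pairing_coanchor (x : M) (α : Cotangent (EM := EM) x) (e : E x) :
    C.pairing x (coanchor C x α) e = α (C.anchor x e) := by
  have := finiteDimensional_fibre F (E := E) x
  simp [coanchor]



/-- A smooth isotropic splitting `∇ : TM → E` of the anchor. -/
structure IsotropicSplitting where
  toFun : ∀ x, TangentSpace 𝓘(ℝ, EM) x →ₗ[ℝ] E x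
  smooth : ∀ X : Cₛ^∞⟮𝓘(ℝ, EM); EM, (TangentSpace 𝓘(ℝ, EM) : M → Type _)⟯,
    ContMDiff 𝓘(ℝ, EM) (𝓘(ℝ, EM).prod 𝓘(ℝ, F)) ∞
      (fun x => (⟨x, toFun x (X x)⟩ : TotalSpace F E))
  anchor_toFun : ∀ x X, C.anchor x (toFun x X) = X
  isotropic : ∀ x X Y, C.pairing x (toFun x X) (toFun x Y) = 0

variable {C} in
/-- The cotangent component `s_∇ : E_x → T_x^*M` of `(∇ + p^*)⁻¹`, namely
`s_∇ e = ⟨e, ∇ ·⟩`. -/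
def IsotropicSplitting.covector (nab : IsotropicSplitting C) (x : M) (e : E x) :
    Cotangent (EM := EM) x :=
  C.pairing x e ∘ₗ nab.toFun x

variable {C} in
/-- `∇ (p e) + p^* (s_∇ e) = e`, so that `e ↦ (p e, s_∇ e)` is indeed `(∇ + p^*)⁻¹`. -/
theorem IsotropicSplitting.decomposition (nab : IsotropicSplitting C) (x : M) (e : E x) :
    nab.toFun x (C.anchor x e) + coanchor C x (nab.covector x e) = e := by
  have h0 : C.anchor x (e - nab.toFun x (C.anchor x e)) = 0 := by
    rw [map_sub, nab.anchor_toFun, sub_self]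
  obtain ⟨α, hα⟩ := (C.exact_middle x _).1 h0
  have hα' : α = nab.covector x e := by
    ext X
    have h := hα (nab.toFun x X)
    rw [nab.anchor_toFun] at h
    rw [← h]
    simp [IsotropicSplitting.covector, nab.isotropic]
  have h2 : coanchor C x α = e - nab.toFun x (C.anchor x e) := by
    have hz : ∀ e', C.pairing x (coanchor C x α - (e - nab.toFun x (C.anchor x e))) e' = 0 := by
      intro e'
      rw [map_sub, LinearMap.sub_apply, pairing_coanchor, hα, sub_self]
    exact sub_eq_zero.1 ((C.pairing_nondegenerate x).1 _ hz)
  rw [← hα', h2]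
  abel

/-- A Dirac structure: a smooth subbundle `L ⊂ E` (through every vector of `L` there is a smooth
section of `L`; the rank is constant by the Lagrangian condition) which is Lagrangian, `L = L^⊥`,
and whose smooth sections are closed under the bracket. -/
structure DiracStructure where
  fibre : ∀ x, Submodule ℝ (E x)
  smooth : ∀ x, ∀ e ∈ fibre x, ∃ s : Cₛ^∞⟮𝓘(ℝ, EM); F, E⟯, s x = e ∧ ∀ y, s y ∈ fibre y
  lagrangian : ∀ x, (C.pairing x).orthogonal (fibre x) = fibre x
  integrable : ∀ s t : Cₛ^∞⟮𝓘(ℝ, EM); F, E⟯, (∀ y, s y ∈ fibre y) → (∀ y, t y ∈ fibre y) →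
    ∀ y, C.bracket s t y ∈ fibre y

end Courant2

/-! ### Lifted actions, admissible splittings -/

section Action

variable {EM : Type*} [NormedAddCommGroup EM] [NormedSpace ℝ EM]
  {M : Type*} [TopologicalSpace M] [ChartedSpace EM M] [IsManifold 𝓘(ℝ, EM) ∞ M]
  {F : Type*} [NormedAddCommGroup F] [NormedSpace ℝ F] [FiniteDimensional ℝ F]
  {E : M → Type*} [TopologicalSpace (TotalSpace F E)] [∀ x, TopologicalSpace (E x)]
  [∀ x, AddCommGroup (E x)] [∀ x, Module ℝ (E x)] [FiberBundle F E] [VectorBundle ℝ F E]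
  (C : ExactCourantAlgebroid EM M F E)
  (EG : Type*) [NormedAddCommGroup EG] [NormedSpace ℝ EG]
  (G : Type*) [TopologicalSpace G] [ChartedSpace EG G] [Group G] [LieGroup 𝓘(ℝ, EG) ∞ G]
  [MulAction G M]

/-- A `G`-lifted action on `E`: a smooth action `𝒜` of `G` on `E` by automorphisms of the Courant
algebroid, covering the action on `M`, and a bracket preserving linear map `χ : 𝔤 → Γ(E)` such
that the infinitesimal action of `u ∈ 𝔤` is `[χ(u), ·]`. -/
structure LiftedAction where
  act : ∀ (g : G) (x : M), E x →ₗ[ℝ] E (g • x)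
  act_one : ∀ x (e : E x), (⟨(1 : G) • x, act 1 x e⟩ : TotalSpace F E) = ⟨x, e⟩
  act_mul : ∀ (g h : G) x (e : E x), (⟨(g * h) • x, act (g * h) x e⟩ : TotalSpace F E) =
    ⟨g • h • x, act g (h • x) (act h x e)⟩
  smooth_act : ContMDiff (𝓘(ℝ, EG).prod (𝓘(ℝ, EM).prod 𝓘(ℝ, F))) (𝓘(ℝ, EM).prod 𝓘(ℝ, F)) ∞
    (fun p : G × TotalSpace F E => (⟨p.1 • p.2.1, act p.1 p.2.1 p.2.2⟩ : TotalSpace F E))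
  act_pairing : ∀ g x e e', C.pairing (g • x) (act g x e) (act g x e') = C.pairing x e e'
  act_anchor : ∀ g x e, C.anchor (g • x) (act g x e) =
    mfderiv 𝓘(ℝ, EM) 𝓘(ℝ, EM) (fun y : M => g • y) x (C.anchor x e)
  /-- `𝒜_g [e₁, e₂] = [𝒜_g e₁, 𝒜_g e₂]`; here `e₁'`, `e₂'` are the transported sections
  `𝒜_g e₁`, `𝒜_g e₂`. -/
  act_bracket : ∀ (g : G) (e₁ e₂ e₁' e₂' : Cₛ^∞⟮𝓘(ℝ, EM); F, E⟯),
    (∀ x, e₁' (g • x) = act g x (e₁ x)) → (∀ x, e₂' (g • x) = act g x (e₂ x)) →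
      ∀ x, C.bracket e₁' e₂' (g • x) = act g x (C.bracket e₁ e₂ x)
  chi : GroupLieAlgebra 𝓘(ℝ, EG) G →ₗ[ℝ] Cₛ^∞⟮𝓘(ℝ, EM); F, E⟯
  chi_lie : ∀ u v, chi ⁅u, v⁆ = C.bracket (chi u) (chi v)
  /-- The derivative at `g = 1` in the direction `u` of the curve
  `g ↦ (𝒜_g e)(x) = 𝒜_g (e (g⁻¹ x))` in the vector space `E_x` is `[χ(u), e](x)`. The fibre `E_x`
  is identified with the model space `F` by the preferred trivialization at `x`. -/
  infinitesimal : ∀ (u : GroupLieAlgebra 𝓘(ℝ, EG) G) (e : Cₛ^∞⟮𝓘(ℝ, EM); F, E⟯) (x : M),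
    NormedSpace.fromTangentSpace _ (mfderiv 𝓘(ℝ, EG) 𝓘(ℝ, F)
      (fun g : G => (trivializationAt F E x
        (⟨g • g⁻¹ • x, act g (g⁻¹ • x) (e (g⁻¹ • x))⟩ : TotalSpace F E)).2) 1 u) =
    (trivializationAt F E x (⟨x, C.bracket (chi u) e x⟩ : TotalSpace F E)).2

variable {C EG G}

/-- `⟨χ(u), χ(u)⟩ = 0` for all `u`. -/
def LiftedAction.IsIsotropic (A : LiftedAction C EG G) : Prop :=
  ∀ u x, C.pairing x (A.chi u x) (A.chi u x) = 0

/-- The action of `g` on the total space of `E`. -/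
def LiftedAction.onTotal (A : LiftedAction C EG G) (g : G) (v : TotalSpace F E) :
    TotalSpace F E :=
  ⟨g • v.1, A.act g v.1 v.2⟩

/-- The subbundle `L` is preserved by the lifted action. -/
def DiracStructure.IsInvariant (L : DiracStructure C) (A : LiftedAction C EG G) : Prop :=
  ∀ g x, ∀ e ∈ L.fibre x, A.act g x e ∈ L.fibre (g • x)

/-- The splitting is `G`-invariant: `𝒜_g ∘ ∇ = ∇ ∘ (ψ_g)_*`. -/
def IsotropicSplitting.IsInvariant (nab : IsotropicSplitting C) (A : LiftedAction C EG G) : Prop :=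
  ∀ g x X, A.act g x (nab.toFun x X) =
    nab.toFun (g • x) (mfderiv 𝓘(ℝ, EM) 𝓘(ℝ, EM) (fun y : M => g • y) x X)

/-- The moment one-form `ξ_∇(u)`: the `T^*M`-component of `χ(u)` under `E ≅ TM ⊕ T^*M`. -/
def IsotropicSplitting.momentForm (nab : IsotropicSplitting C) (A : LiftedAction C EG G)
    (u : GroupLieAlgebra 𝓘(ℝ, EG) G) (x : M) : Cotangent (EM := EM) x :=
  nab.covector x (A.chi u x)

variable (EM M G) in
/-- A submanifold `j : N → M` (injective immersion) which is invariant under `G` and on which `G`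
acts freely; `N` carries the (smooth) restricted action. -/
structure FreeInvariantSubmanifold (EG : Type*) [NormedAddCommGroup EG] [NormedSpace ℝ EG]
    [ChartedSpace EG G]
    (EN : Type*) [NormedAddCommGroup EN] [NormedSpace ℝ EN]
    (N : Type*) [TopologicalSpace N] [ChartedSpace EN N] [MulAction G N] where
  incl : N → M
  smooth : ContMDiff 𝓘(ℝ, EN) 𝓘(ℝ, EM) ∞ incl
  injective : Function.Injective incl
  immersion : ∀ x, Function.Injective (mfderiv 𝓘(ℝ, EN) 𝓘(ℝ, EM) incl x)
  equivariant : ∀ (g : G) x, incl (g • x) = g • incl x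
  smooth_smul : ContMDiff (𝓘(ℝ, EG).prod 𝓘(ℝ, EN)) 𝓘(ℝ, EN) ∞ (fun p : G × N => p.1 • p.2)
  free : ∀ (g : G) (x : N), g • x = x → g = 1

end Action

/-! ### Reduction -/

section Reduction

variable {EM : Type*} [NormedAddCommGroup EM] [NormedSpace ℝ EM]
  {M : Type*} [TopologicalSpace M] [ChartedSpace EM M] [IsManifold 𝓘(ℝ, EM) ∞ M]
  {F : Type*} [NormedAddCommGroup F] [NormedSpace ℝ F] [FiniteDimensional ℝ F]
  {E : M → Type*} [TopologicalSpace (TotalSpace F E)] [∀ x, TopologicalSpace (E x)]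
  [∀ x, AddCommGroup (E x)] [∀ x, Module ℝ (E x)] [FiberBundle F E] [VectorBundle ℝ F E]
  {C : ExactCourantAlgebroid EM M F E}
  {EG : Type*} [NormedAddCommGroup EG] [NormedSpace ℝ EG]
  {G : Type*} [TopologicalSpace G] [ChartedSpace EG G] [Group G] [LieGroup 𝓘(ℝ, EG) ∞ G]
  [MulAction G M]
  {EN : Type*} [NormedAddCommGroup EN] [NormedSpace ℝ EN]
  {N : Type*} [TopologicalSpace N] [ChartedSpace EN N] [MulAction G N]
  (A : LiftedAction C EG G) (S : FreeInvariantSubmanifold EM M G EG EN N)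
  (nab : IsotropicSplitting C) (L : DiracStructure C)

/-- The differential `dj_x : T_xN → T_{j(x)}M` of the inclusion. -/
def FreeInvariantSubmanifold.dincl (x : N) :
    TangentSpace 𝓘(ℝ, EN) x →ₗ[ℝ] TangentSpace 𝓘(ℝ, EM) (S.incl x) :=
  (mfderiv 𝓘(ℝ, EN) 𝓘(ℝ, EM) S.incl x).toLinearMap

/-- `∇` is `(𝒜, χ, N)`-admissible: it is invariant and `j^* ξ_∇ = 0`. -/
def IsotropicSplitting.IsAdmissible : Prop :=
  nab.IsInvariant A ∧ ∀ u (x : N), nab.momentForm A u (S.incl x) ∘ₗ S.dincl x = 0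

/-- `K_x = {χ(u)(x) | u ∈ 𝔤} + p^*(Ann T_xN)`. -/
def isoK (x : N) : Submodule ℝ (E (S.incl x)) :=
  Submodule.span ℝ (Set.range fun u => A.chi u (S.incl x)) ⊔
    (Submodule.dualAnnihilator (LinearMap.range (S.dincl x))).map (coanchor C (S.incl x))

/-- `K_x^⊥`. -/
def isoKPerp (x : N) : Submodule ℝ (E (S.incl x)) :=
  (C.pairing (S.incl x)).orthogonal (isoK A S x)

/-- The fibre `K_x^⊥ / K_x`. -/
abbrev PerpModK (x : N) : Type _ :=
  isoKPerp A S x ⧸ (isoK A S x).submoduleOf (isoKPerp A S x)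

/-- The class `e + K_x` of `e ∈ K_x^⊥`. -/
def cls (x : N) : isoKPerp A S x →ₗ[ℝ] PerpModK A S x :=
  Submodule.mkQ _

/-- The total space of the bundle `K^⊥ / K` over `N`. -/
abbrev PerpModKTotal : Type _ := Σ x : N, PerpModK A S x

/-- The element `e + K_x` of `K^⊥ / K` and its image `𝒜_g e + K_{gx}` under `g` are related. -/
def OrbitRel (a b : PerpModKTotal A S) : Prop :=
  ∃ (g : G) (e : isoKPerp A S a.1) (e' : isoKPerp A S b.1),
    cls A S a.1 e = a.2 ∧ cls A S b.1 e' = b.2 ∧ b.1 = g • a.1 ∧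
    (⟨S.incl b.1, e'⟩ : TotalSpace F E) = A.onTotal g ⟨S.incl a.1, e⟩

/-- The `G`-orbit of an element of `K^⊥ / K`. -/
def orbitOf (a : PerpModKTotal A S) : Set (PerpModKTotal A S) := {b | OrbitRel A S a b}

variable (G N) in
/-- The reduced space `M_red = N / G`. -/
abbrev MRed : Type _ := MulAction.orbitRel.Quotient G N

variable (G N) in
/-- The quotient map `q : N → M_red`. -/
def quot (x : N) : MRed G N := Quotient.mk'' x

/-- The fibre over `y` of `E_red = (K^⊥ / K) / G`: the set of `G`-orbits in `K^⊥ / K` lying over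
`y ∈ N / G`. -/
def ERed (y : MRed G N) : Set (Set (PerpModKTotal A S)) :=
  {z | ∃ a : PerpModKTotal A S, quot G N a.1 = y ∧ z = orbitOf A S a}

/-- Addition in the fibres of `E_red`: fibrewise addition of orbits in `K^⊥ / K`. -/
def addRed (z w : Set (PerpModKTotal A S)) : Set (PerpModKTotal A S) :=
  {c | ∃ a b : PerpModK A S c.1, ⟨c.1, a⟩ ∈ z ∧ ⟨c.1, b⟩ ∈ w ∧ c.2 = a + b}

/-- `L_red = (L|_N ∩ K^⊥ + K) / K / G`, in the fibre over `y`. -/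
def LRed (y : MRed G N) : Set (Set (PerpModKTotal A S)) :=
  {z | ∃ (x : N) (e : isoKPerp A S x), quot G N x = y ∧
    (e : E (S.incl x)) ∈ L.fibre (S.incl x) ⊓ isoKPerp A S x ⊔ isoK A S x ∧
    z = orbitOf A S ⟨x, cls A S x e⟩}

/-- The pairing induced on `K_x^⊥ / K_x`. -/
def pairRed (x : N) : PerpModK A S x →ₗ[ℝ] PerpModK A S x →ₗ[ℝ] ℝ :=
  Submodule.liftQ _
    { toFun := fun e => Submodule.liftQ _
        ((C.pairing (S.incl x)) e ∘ₗ (isoKPerp A S x).subtype) (by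
          intro k hk
          have h : C.pairing _ (k : E (S.incl x)) (e : E (S.incl x)) = 0 := e.2 _ hk
          simpa [C.pairing_symm _ (e : E (S.incl x))] using h)
      map_add' := by
        intro a b
        ext c
        simp
      map_smul' := by
        intro r a
        ext c
        simp }
    (by
      intro k hk
      ext c
      simpa using c.2 _ hk)

section Quotient

variable {ER : Type*} [NormedAddCommGroup ER] [NormedSpace ℝ ER] [ChartedSpace ER (MRed G N)]

variable (G N EN ER) in
/-- The manifold structure on `N / G` is the quotient one: `q` is a smooth submersion. -/
def IsQuotientManifold : Prop :=
  ContMDiff 𝓘(ℝ, EN) 𝓘(ℝ, ER) ∞ (quot G N) ∧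
    ∀ x, Function.Surjective (mfderiv 𝓘(ℝ, EN) 𝓘(ℝ, ER) (quot G N) x)

variable (G EN ER) in
/-- The differential `dq_x : T_xN → T_{q(x)}M_red`. -/
def dquot (x : N) : TangentSpace 𝓘(ℝ, EN) x →ₗ[ℝ] TangentSpace 𝓘(ℝ, ER) (quot G N x) :=
  (mfderiv 𝓘(ℝ, EN) 𝓘(ℝ, ER) (quot G N) x).toLinearMap

/-- The anchor of `E_red`, `p_red [e + K] = dq (p e)`: the element `a = e + K_x`, where
`p e = dj_x X` with `X ∈ T_xN`, is mapped to `dq_x X`. -/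
def AnchorRed (a : PerpModKTotal A S) (Y : TangentBundle 𝓘(ℝ, ER) (MRed G N)) : Prop :=
  ∃ (e : isoKPerp A S a.1) (X : TangentSpace 𝓘(ℝ, EN) a.1), cls A S a.1 e = a.2 ∧
    C.anchor _ e = S.dincl a.1 X ∧ Y = ⟨quot G N a.1, dquot G EN ER a.1 X⟩

/-- `p_red^* η ∈ E_red|_y` for `η ∈ T_y^* M_red`: the orbit of the elements `a` of `K^⊥ / K` with
`⟨a, b⟩_red = η (p_red b)` for all `b`. -/
def coanchorRed (y : MRed G N) (η : Cotangent (EM := ER) y) : Set (PerpModKTotal A S) :=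
  {a | quot G N a.1 = y ∧ ∀ (b : PerpModK A S a.1) (Y : TangentSpace 𝓘(ℝ, ER) y),
    AnchorRed A S ⟨a.1, b⟩ ⟨y, Y⟩ → pairRed A S a.1 a.2 b = η Y}

/-- `∇_red Y ∈ E_red|_y` for `Y ∈ T_y M_red`: the orbit of the elements `∇X + K_x` of `K^⊥ / K`
with `dq_x X = Y`. -/
def nablaRed (Y : TangentBundle 𝓘(ℝ, ER) (MRed G N)) : Set (PerpModKTotal A S) :=
  {a | ∃ (e : isoKPerp A S a.1) (X : TangentSpace 𝓘(ℝ, EN) a.1), cls A S a.1 e = a.2 ∧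
    (e : E (S.incl a.1)) = nab.toFun _ (S.dincl a.1 X) ∧
    Y = ⟨quot G N a.1, dquot G EN ER a.1 X⟩}

/-- `∇_red Y + p_red^* η` for `Y + η ∈ T_yM_red ⊕ T_y^*M_red`. -/
def splitRed (y : MRed G N) (v : TangentSpace 𝓘(ℝ, ER) y × Cotangent (EM := ER) y) :
    Set (PerpModKTotal A S) :=
  addRed A S (nablaRed A S nab ⟨y, v.1⟩) (coanchorRed A S y v.2)

/-- The backward image (restriction to `N`)
`𝔅j(L_x) = {X + dj_x^* β | ∇X + p^*β ∈ L_x} ⊂ T_xN ⊕ T_x^*N`. -/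
def backward (x : N) : Set (TangentSpace 𝓘(ℝ, EN) x × Cotangent (EM := EN) x) :=
  {v | ∃ β : Cotangent (EM := EM) (S.incl x), v.2 = β ∘ₗ S.dincl x ∧
    nab.toFun _ (S.dincl x v.1) + coanchor C _ β ∈ L.fibre (S.incl x)}

variable (ER) in
/-- The forward image `{dq_x X + η | X + dq_x^* η ∈ B}` of `B ⊂ T_xN ⊕ T_x^*N`. -/
def forward (x : N) (B : Set (TangentSpace 𝓘(ℝ, EN) x × Cotangent (EM := EN) x)) :
    Set (TangentSpace 𝓘(ℝ, ER) (quot G N x) × Cotangent (EM := ER) (quot G N x)) :=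
  {v | ∃ X, v.1 = dquot G EN ER x X ∧ (X, v.2 ∘ₗ dquot G EN ER x) ∈ B}

end Quotient

end Reduction

end DiracReduction

end

open DiracReduction

open Filter Topology Asymptotics

set_option linter.unusedSectionVars false

namespace DiracReduction

/-! The splitting identifies `E_x` with `T_xM ⊕ T_x^*M` carrying the canonical pairing.
Admissibility says that `χ(u)` equals `∇ p(χ(u))` modulo `p^*(Ann T_xN)`. Once the vectors `p(χ(u))`
are known to fill out `ker dq_x`, the space `K_x` therefore consists of the `∇X + p^*β` with `dq_x X
= 0` and `dj_x^*β = 0`, while `K_x^⊥` consists of those with `X` tangent to `N` and `dj_x^*β =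
dq_x^*η` for some `η`. Sending such an element to `(dq_x X, η)` identifies `K_x^⊥ / K_x` with
`TM_red ⊕ T^*M_red`: see `hasCoords_zero_iff`, `exists_coords_of_mem_isoKPerp` and
`exists_hasCoords`.

The lifted action preserves these coordinates, so a point of `E_red` is the set of all classes over
one orbit with given coordinates (`orbitOf_eq_coordSet`). Then `∇_red Y + p_red^*η` has coordinates
`(Y, η)`, and it lies in `L_red` exactly when `L_x` contains a vector with these coordinates
(`coordSet_mem_LRed_iff`), which is the backward image condition. Coordinates live in the fixed
space `ER × Module.Dual ℝ ER`, so that different points of an orbit are compared without transport.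

The analytic input is `IsVerticalSpan`. That `p(χ(u))` generates the action on `M` follows by
comparing the Leibniz rule with the derivative of `g ↦ 𝒜_g(f e)` (`LiftedAction.anchor_chi`). That
every vector in `ker dq_x` arises this way (`mem_range_mfderiv_orbitMap`) follows by lifting a curve
in a fibre of `q` to `G`: freeness makes the orbit map an injective immersion, and compactness makes
it a closed embedding. -/

/-- If a curve `g` lifts a differentiable curve through an immersion `θ`, then the velocity of
`θ ∘ g` is tangent to the image of `θ`. No differentiability of `g` is assumed. -/
theorem mem_range_of_hasDerivAt_comp
    {A B : Type*} [NormedAddCommGroup A] [NormedSpace ℝ A] [FiniteDimensional ℝ A]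
    [NormedAddCommGroup B] [NormedSpace ℝ B]
    {θ : A → B} {D : A →L[ℝ] B} {a : A} (hθ : HasFDerivAt θ D a) (hD : Function.Injective D)
    {g : ℝ → A} (hg : Tendsto g (𝓝 0) (𝓝 a)) (hg0 : g 0 = a) {v : B}
    (hv : HasDerivAt (fun t => θ (g t)) v 0) : v ∈ LinearMap.range (D : A →ₗ[ℝ] B) := by
  obtain ⟨K, -, hK⟩ := (D : A →ₗ[ℝ] B).exists_antilipschitzWith (LinearMap.ker_eq_bot.2 hD)
  -- Injectivity of `D` bounds `g t - a` by `D (g t - a)`, and the remainder of `θ` is negligible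
  -- against the latter. So `θ` controls `g`, and `g t - a` is `O(t)` although `g` need not be
  -- differentiable.
  have h1 : (fun t => g t - a) =O[𝓝 0] fun t => θ (g t) - θ a :=
by
    have hr : (fun t => g t - a) =O[𝓝 0] fun t => D (g t - a) :=
      IsBigO.of_bound K (Eventually.of_forall fun t => hK.le_mul_norm (map_zero D) _)
    have ho := ((hθ.isLittleO.comp_tendsto hg).trans_isBigO hr).right_isBigO_add
    refine hr.trans (ho.congr_right fun t => ?_)
    simp
  have h2 : (fun t => θ (g t) - θ a) =O[𝓝 0] fun t : ℝ => t := by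
    simpa [hg0] using hv.isBigO_sub
  have h3 : (fun t => θ (g t) - θ a - D (g t - a)) =o[𝓝 0] fun t : ℝ => t :=
    (hθ.isLittleO.comp_tendsto hg).trans_isBigO (h1.trans h2)
  have h4 : (fun t => θ (g t) - θ a - t • v) =o[𝓝 0] fun t : ℝ => t := by
    simpa [hg0] using hv.isLittleO
  have h5 : (fun t => D (g t - a) - t • v) =o[𝓝 0] fun t : ℝ => t := by
    refine (h4.sub h3).congr_left fun t => ?_
    abel
  have h6 : Tendsto (fun t : ℝ => D (t⁻¹ • (g t - a)) - v) (𝓝[≠] 0) (𝓝 0) := by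
    have h := (h5.mono (nhdsWithin_le_nhds (s := {0}ᶜ))).tendsto_inv_smul_nhds_zero
    refine h.congr' ?_
    filter_upwards [self_mem_nhdsWithin] with t ht
    rw [smul_sub, smul_smul, inv_mul_cancel₀ ht, one_smul, map_smul]
  have h7 : Tendsto (fun t : ℝ => D (t⁻¹ • (g t - a))) (𝓝[≠] 0) (𝓝 v) := by
    simpa using h6.add_const v
  -- The difference quotients lie in the range of `D`, which is closed because it is
  -- finite-dimensional.
  exact (LinearMap.range (D : A →ₗ[ℝ] B)).closed_of_finiteDimensional.mem_of_tendsto h7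
    (Eventually.of_forall fun t => ⟨_, rfl⟩)

/-! ### Orbit maps of a free action and the kernel of `dq`. -/

section Orbit

variable {EG : Type*} [NormedAddCommGroup EG] [NormedSpace ℝ EG]
  {G : Type*} [TopologicalSpace G] [ChartedSpace EG G] [Group G] [LieGroup 𝓘(ℝ, EG) ∞ G]
  {EN : Type*} [NormedAddCommGroup EN] [NormedSpace ℝ EN]
  {N : Type*} [TopologicalSpace N] [ChartedSpace EN N] [MulAction G N]

theorem contMDiff_orbitMap
    (hs : ContMDiff (𝓘(ℝ, EG).prod 𝓘(ℝ, EN)) 𝓘(ℝ, EN) ∞ (fun p : G × N => p.1 • p.2)) (x : N) :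
    ContMDiff 𝓘(ℝ, EG) 𝓘(ℝ, EN) ∞ (fun g : G => g • x) :=
  hs.comp (contMDiff_id.prodMk contMDiff_const)

theorem contMDiff_const_smul_of_smul
    (hs : ContMDiff (𝓘(ℝ, EG).prod 𝓘(ℝ, EN)) 𝓘(ℝ, EN) ∞ (fun p : G × N => p.1 • p.2)) (g : G) :
    ContMDiff 𝓘(ℝ, EN) 𝓘(ℝ, EN) ∞ (fun x : N => g • x) :=
  hs.comp (contMDiff_const.prodMk contMDiff_id)

/-- A curve in a manifold with vanishing derivative near `0` is constant near `0`. -/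
theorem eventually_eq_of_hasMFDerivAt_zero {c : ℝ → N}
    (hc : ∀ᶠ t in 𝓝 (0 : ℝ), HasMFDerivAt 𝓘(ℝ, ℝ) 𝓘(ℝ, EN) c t 0) [IsManifold 𝓘(ℝ, EN) ∞ N] :
    ∀ᶠ t in 𝓝 (0 : ℝ), c t = c 0 := by
  have hc0 : ContinuousAt c 0 := hc.self_of_nhds.continuousAt
  have hsrc : ∀ᶠ t in 𝓝 (0 : ℝ), c t ∈ (chartAt EN (c 0)).source :=
    hc0.eventually ((chartAt EN (c 0)).open_source.mem_nhds (mem_chart_source _ _))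
  obtain ⟨ε, hε, hball⟩ := Metric.eventually_nhds_iff_ball.1 (hc.and hsrc)
  have hd : ∀ t ∈ Metric.ball (0 : ℝ) ε,
      HasDerivWithinAt (fun s => extChartAt 𝓘(ℝ, EN) (c 0) (c s)) 0 (Metric.ball 0 ε) t := by
    intro t ht
    obtain ⟨h1, h2⟩ := hball t ht
    have h3 := ((mdifferentiableAt_extChartAt (I := 𝓘(ℝ, EN)) h2).hasMFDerivAt).comp t h1
    rw [ContinuousLinearMap.comp_zero] at h3
    have h4 : HasFDerivAt (fun s => extChartAt 𝓘(ℝ, EN) (c 0) (c s)) (0 : ℝ →L[ℝ] EN) t :=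
      h3.hasFDerivAt
    exact h4.hasDerivAt.hasDerivWithinAt
  filter_upwards [Metric.ball_mem_nhds (0 : ℝ) hε] with t ht
  have h0 : (0 : ℝ) ∈ Metric.ball (0 : ℝ) ε := Metric.mem_ball_self hε
  have h5 : extChartAt 𝓘(ℝ, EN) (c 0) (c t) = extChartAt 𝓘(ℝ, EN) (c 0) (c 0) := by
    have := (convex_ball (0 : ℝ) ε).norm_image_sub_le_of_norm_hasDerivWithin_le (C := 0)
      hd (by simp) h0 ht
    simpa [sub_eq_zero] using this
  refine (extChartAt 𝓘(ℝ, EN) (c 0)).injOn ?_ ?_ h5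
  · rw [extChartAt_source]; exact (hball t ht).2
  · rw [extChartAt_source]; exact (hball 0 h0).2

variable [FiniteDimensional ℝ EG] [IsManifold 𝓘(ℝ, EN) ∞ N]

/-- The orbit maps of a free action are immersions at `1`. -/
theorem mfderiv_orbitMap_injective
    (hs : ContMDiff (𝓘(ℝ, EG).prod 𝓘(ℝ, EN)) 𝓘(ℝ, EN) ∞ (fun p : G × N => p.1 • p.2))
    (hfree : ∀ (g : G) (x : N), g • x = x → g = 1) (x : N) :
    Function.Injective (mfderiv 𝓘(ℝ, EG) 𝓘(ℝ, EN) (fun g : G => g • x) 1) := by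
  refine (injective_iff_map_eq_zero _).2 fun u hu => ?_
  have : LieGroup 𝓘(ℝ, EG) (minSmoothness ℝ 3) G := by
    rw [minSmoothness_of_isRCLikeNormedField]
    exact LieGroup.of_le (n := ∞) (by exact WithTop.coe_le_coe.2 le_top)
  have hθ := contMDiff_orbitMap (G := G) hs x
  -- Equivariance of the orbit map carries the kernel vector `u` at `1` to the whole left-invariant
  -- field of `u`.
  have hX : ∀ g : G, mfderiv 𝓘(ℝ, EG) 𝓘(ℝ, EN) (fun g : G => g • x) g
      (mulInvariantVectorField u g) = 0 := by
    intro g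
    have h1 : (fun h : G => h • x) ∘ (fun h : G => g * h) =
        (fun y : N => g • y) ∘ fun h : G => h • x := by
      ext h
      exact mul_smul g h x
    have h2 := mfderiv_comp_apply_of_eq (I' := 𝓘(ℝ, EG)) (1 : G) (hθ.mdifferentiable (by simp) g)
      ((contMDiff_mul_left (I := 𝓘(ℝ, EG)) (n := ∞) (a := g)).mdifferentiable (by simp) 1)
      (mul_one g) u
    have h3 := mfderiv_comp_apply (I' := 𝓘(ℝ, EN)) (1 : G)
      ((contMDiff_const_smul_of_smul hs g).mdifferentiable (by simp) ((1 : G) • x))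
      (hθ.mdifferentiable (by simp) 1) u
    rw [mulInvariantVectorField]
    refine h2.symm.trans ?_
    rw [h1]
    refine h3.trans ?_
    rw [hu]
    exact map_zero _
  have hcm : ContMDiffAt 𝓘(ℝ, EG) 𝓘(ℝ, EG).tangent 1
      (fun g : G => (⟨g, mulInvariantVectorField u g⟩ : TangentBundle 𝓘(ℝ, EG) G)) 1 :=
    (contMDiffAt_mulInvariantVectorField u).of_le (by
      rw [minSmoothness_of_isRCLikeNormedField]; norm_num)
  have hcomp : CompleteSpace EG := FiniteDimensional.complete ℝ EG
  have hman : IsManifold 𝓘(ℝ, EG) 1 G := IsManifold.of_le (n := ∞) (by simp)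
  -- An integral curve of this field has a stationary image in `N`. Freeness makes the curve itself
  -- stationary, and its velocity at `0` is `u`.
  obtain ⟨γ, hγ0, hγ⟩ := exists_isMIntegralCurveAt_of_contMDiffAt_boundaryless
    (I := 𝓘(ℝ, EG)) 0 hcm
  have hconst : ∀ᶠ t in 𝓝 (0 : ℝ), γ t • x = γ 0 • x := by
    refine eventually_eq_of_hasMFDerivAt_zero (EN := EN) (c := fun t => γ t • x) ?_
    filter_upwards [hγ] with t ht
    have h := ((hθ.mdifferentiable (by simp) (γ t)).hasMFDerivAt).comp t ht
    refine h.congr_mfderiv (ContinuousLinearMap.ext fun (r : ℝ) => ?_)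
    refine (map_smul (mfderiv 𝓘(ℝ, EG) 𝓘(ℝ, EN) (fun g : G => g • x) (γ t)) r
      (mulInvariantVectorField u (γ t))).trans ?_
    rw [hX, smul_zero]
    rfl
  have hγc : γ =ᶠ[𝓝 0] fun _ => (1 : G) := by
    filter_upwards [hconst] with t ht
    exact hfree _ x (by rw [ht, hγ0, one_smul])
  have h1 := hγ.self_of_nhds
  have h2 : HasMFDerivAt 𝓘(ℝ, ℝ) 𝓘(ℝ, EG) γ 0 0 :=
    (hasMFDerivAt_const (1 : G) (0 : ℝ)).congr_of_eventuallyEq hγc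
  have h3 := congrArg (fun T => T (1 : ℝ)) (hasMFDerivAt_unique h1 h2)
  have h4 : mulInvariantVectorField u (γ 0) = 0 := (one_smul ℝ _).symm.trans h3
  rw [hγ0] at h4
  have h5 : (fun h : G => 1 * h) = id := funext one_mul
  rw [mulInvariantVectorField, h5, mfderiv_id] at h4
  exact h4

/-- The vertical tangent vectors of the quotient of a manifold by a free action of a compact group
are tangent to the orbits. -/
theorem mem_range_mfderiv_orbitMap [CompactSpace G] [T2Space N] [FiniteDimensional ℝ EN]
    {ER : Type*} [NormedAddCommGroup ER] [NormedSpace ℝ ER] [FiniteDimensional ℝ ER]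
    [ChartedSpace ER (MRed G N)] [IsManifold 𝓘(ℝ, ER) ∞ (MRed G N)]
    (hs : ContMDiff (𝓘(ℝ, EG).prod 𝓘(ℝ, EN)) 𝓘(ℝ, EN) ∞ (fun p : G × N => p.1 • p.2))
    (hfree : ∀ (g : G) (x : N), g • x = x → g = 1) (hq : IsQuotientManifold G EN N ER)
    (x : N) (X : TangentSpace 𝓘(ℝ, EN) x) (hX : mfderiv 𝓘(ℝ, EN) 𝓘(ℝ, ER) (quot G N) x X = 0) :
    ∃ u, (mfderiv 𝓘(ℝ, EG) 𝓘(ℝ, EN) (fun g : G => g • x) 1 u : EN) = X := by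
  have hθ := contMDiff_orbitMap (G := G) hs x
  have hinj : Function.Injective fun g : G => g • x := by
    intro g h hgh
    have := hfree (h⁻¹ * g) x (by
      rw [mul_smul, show g • x = h • x from hgh, inv_smul_smul])
    exact (inv_mul_eq_one.1 this).symm
  have hemb : IsClosedEmbedding fun g : G => g • x := hθ.continuous.isClosedEmbedding hinj
  set qc : EN → ER := extChartAt 𝓘(ℝ, ER) (quot G N x) ∘ quot G N ∘ (extChartAt 𝓘(ℝ, EN) x).symm
    with hqc
  set a : EN := extChartAt 𝓘(ℝ, EN) x x with ha
  let D : EN →L[ℝ] ER := mfderiv 𝓘(ℝ, EN) 𝓘(ℝ, ER) (quot G N) x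
  have hDr : (D : EN →ₗ[ℝ] ER).range = ⊤ := LinearMap.range_eq_top.2 (hq.2 x)
  have hqd : HasStrictFDerivAt qc D a := by
    have h1 : ContDiffAt ℝ ∞ qc a := by
      have := (contMDiffAt_iff.1 (hq.1.contMDiffAt (x := x))).2
      simpa [contDiffWithinAt_univ, hqc, ha] using this
    have h2 := h1.hasStrictFDerivAt (by simp)
    have h3 : HasFDerivAt qc D a := by
      have h : HasFDerivWithinAt qc D (Set.range 𝓘(ℝ, EN)) a :=
        ((hq.1.mdifferentiable (by simp) x).hasMFDerivAt).2
      rwa [modelWithCornersSelf_coe, Set.range_id, hasFDerivWithinAt_univ] at h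
    rwa [h2.hasFDerivAt.unique h3] at h2
  have hcEN : CompleteSpace EN := FiniteDimensional.complete ℝ EN
  let v : (D : EN →ₗ[ℝ] ER).ker := ⟨X, hX⟩
  -- The implicit function theorem, applied to `q` in charts, gives a curve inside the fibre of `q`
  -- with initial velocity `X`.
  set φ : ℝ → EN := fun t => hqd.implicitFunction qc D hDr (qc a) (t • v) with hφ
  have hv0 : HasDerivAt (fun t : ℝ => t • v) v 0 := by
    simpa using (hasDerivAt_id (0 : ℝ)).smul_const v
  have hφd : HasDerivAt φ X 0 := by
    have h := hqd.to_implicitFunction hDr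
    rw [← zero_smul ℝ v] at h
    exact h.hasFDerivAt.comp_hasDerivAt (0 : ℝ) hv0
  have hφ0 : φ 0 = a := by simp [hφ]
  have hqφ : ∀ᶠ t in 𝓝 (0 : ℝ), qc (φ t) = qc a := by
    have h : Tendsto (fun t : ℝ => (qc a, t • v)) (𝓝 0) (𝓝 (qc a, 0)) := by
      have h := hv0.continuousAt.tendsto
      rw [zero_smul] at h
      exact tendsto_const_nhds.prodMk_nhds h
    exact h.eventually (hqd.map_implicitFunction_eq hDr)
  set c : ℝ → N := fun t => (extChartAt 𝓘(ℝ, EN) x).symm (φ t) with hc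
  have hc0 : c 0 = x := by simp [hc, hφ0, ha]
  have hφa : Tendsto φ (𝓝 0) (𝓝 a) := by
    have := hφd.continuousAt.tendsto
    rwa [hφ0] at this
  have hcc : Tendsto c (𝓝 0) (𝓝 x) := by
    have h := (continuousAt_extChartAt_symm (I := 𝓘(ℝ, EN)) x).tendsto
    rw [extChartAt_to_inv] at h
    exact h.comp hφa
  have hqcc : ∀ᶠ t in 𝓝 (0 : ℝ), quot G N (c t) = quot G N x := by
    have h := hcc.eventually ((hq.1.continuous.tendsto x).eventually
      (extChartAt_source_mem_nhds (I := 𝓘(ℝ, ER)) (quot G N x)))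
    filter_upwards [h, hqφ] with t h1 h2
    refine (extChartAt 𝓘(ℝ, ER) (quot G N x)).injOn h1 (mem_extChartAt_source _) ?_
    simpa [hqc, ha, hc] using h2
  have hlift : ∀ t, ∃ g : G, quot G N (c t) = quot G N x → g • x = c t := by
    intro t
    by_cases ht : quot G N (c t) = quot G N x
    · obtain ⟨g, hg⟩ := Quotient.exact ht
      exact ⟨g, fun _ => hg⟩
    · exact ⟨1, fun h => absurd h ht⟩
  choose g hg using hlift
  have hgx : ∀ᶠ t in 𝓝 (0 : ℝ), g t • x = c t := hqcc.mono fun t ht => hg t ht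
  have hg0 : g 0 = 1 := hfree _ x (by rw [hgx.self_of_nhds, hc0])
  -- The lift was chosen pointwise; it is continuous at `0` because the orbit map is a topological
  -- embedding.
  have hgt : Tendsto g (𝓝 0) (𝓝 1) := by
    rw [hemb.isInducing.tendsto_nhds_iff]
    refine Tendsto.congr' (hgx.mono fun t ht => ht.symm) ?_
    rwa [one_smul]
  let Dθ : EG →L[ℝ] EN := mfderiv 𝓘(ℝ, EG) 𝓘(ℝ, EN) (fun g : G => g • x) 1
  have hθd : HasFDerivAt
      (extChartAt 𝓘(ℝ, EN) x ∘ (fun g : G => g • x) ∘ (extChartAt 𝓘(ℝ, EG) (1 : G)).symm)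
      Dθ (extChartAt 𝓘(ℝ, EG) (1 : G) 1) := by
    have h : HasFDerivWithinAt
        (extChartAt 𝓘(ℝ, EN) ((1 : G) • x) ∘ (fun g : G => g • x) ∘
          (extChartAt 𝓘(ℝ, EG) (1 : G)).symm)
        Dθ (Set.range 𝓘(ℝ, EG)) (extChartAt 𝓘(ℝ, EG) (1 : G) 1) :=
      ((hθ.mdifferentiable (by simp) (1 : G)).hasMFDerivAt).2
    rwa [modelWithCornersSelf_coe, Set.range_id, hasFDerivWithinAt_univ, one_smul] at h
  obtain ⟨u, hu⟩ := mem_range_of_hasDerivAt_comp hθd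
    (g := fun t => extChartAt 𝓘(ℝ, EG) (1 : G) (g t)) (v := X)
    (mfderiv_orbitMap_injective hs hfree x)
    ((continuousAt_extChartAt (I := 𝓘(ℝ, EG)) (1 : G)).tendsto.comp hgt) (by rw [hg0])
    (by
      refine hφd.congr_of_eventuallyEq ?_
      have h1 := hgt.eventually (extChartAt_source_mem_nhds (I := 𝓘(ℝ, EG)) (1 : G))
      have h2 := hφa.eventually (extChartAt_target_mem_nhds (I := 𝓘(ℝ, EN)) x)
      filter_upwards [h1, h2, hgx] with t h1 h2 h3
      simp only [Function.comp_apply]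
      rw [(extChartAt 𝓘(ℝ, EG) (1 : G)).left_inv h1, h3]
      exact (extChartAt 𝓘(ℝ, EN) x).right_inv h2)
  exact ⟨u, hu⟩

end Orbit

/-! ### Test functions for tangent vectors. -/

section Separation

variable {EM : Type*} [NormedAddCommGroup EM] [NormedSpace ℝ EM] [FiniteDimensional ℝ EM]
  {M : Type*} [TopologicalSpace M] [T2Space M] [ChartedSpace EM M] [IsManifold 𝓘(ℝ, EM) ∞ M]

/-- Smooth functions separate tangent vectors. -/
theorem tangent_eq_of_dirDeriv_eq {x : M} {v w : TangentSpace 𝓘(ℝ, EM) x}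
    (h : ∀ f : M → ℝ, ContMDiff 𝓘(ℝ, EM) 𝓘(ℝ, ℝ) ∞ f → dirDeriv f x v = dirDeriv f x w) :
    v = w := by
  obtain ⟨b⟩ : Nonempty (SmoothBumpFunction 𝓘(ℝ, EM) x) := inferInstance
  let φ : M → EM := extChartAt 𝓘(ℝ, EM) x
  have hman : IsManifold 𝓘(ℝ, EM) 1 M := IsManifold.of_le (n := ∞) (by simp)
  have hinv := isInvertible_mfderiv_extChartAt (I := 𝓘(ℝ, EM)) (mem_extChartAt_source x)
  have hφ : MDifferentiableAt 𝓘(ℝ, EM) 𝓘(ℝ, EM) φ x :=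
    mdifferentiableAt_extChartAt (mem_chart_source EM x)
  refine hinv.injective ((NormedSpace.fromTangentSpace (φ x)).injective
    ((SeparatingDual.eq_iff_forall_dual_eq (R := ℝ)).2 fun l => ?_))
  -- A linear functional of the chart, cut off by a bump function equal to `1` near `x`, is globally
  -- smooth and keeps its derivative at `x`.
  have hf : ContMDiff 𝓘(ℝ, EM) 𝓘(ℝ, ℝ) ∞ fun y => b y • l (φ y) :=
    b.contMDiff_smul (l.contMDiff.comp_contMDiffOn contMDiffOn_extChartAt)
  have heq : (fun y => b y • l (φ y)) =ᶠ[𝓝 x] l ∘ φ := by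
    filter_upwards [b.eventuallyEq_one] with y hy
    simp [hy]
  have key : ∀ z : TangentSpace 𝓘(ℝ, EM) x, dirDeriv (fun y => b y • l (φ y)) x z =
      l (NormedSpace.fromTangentSpace (φ x) (mfderiv 𝓘(ℝ, EM) 𝓘(ℝ, EM) φ x z)) := by
    intro z
    have h1 : mfderiv 𝓘(ℝ, EM) 𝓘(ℝ, ℝ) (fun y => b y • l (φ y)) x =
        mfderiv 𝓘(ℝ, EM) 𝓘(ℝ, ℝ) (l ∘ φ) x := heq.mfderiv_eq
    have h2 := mfderiv_comp_apply (I' := 𝓘(ℝ, EM)) (I'' := 𝓘(ℝ, ℝ)) (g := l) x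
      l.differentiableAt.mdifferentiableAt hφ z
    have h3 : mfderiv 𝓘(ℝ, EM) 𝓘(ℝ, ℝ) l (φ x) = l := by
      rw [mfderiv_eq_fderiv]
      exact l.fderiv
    refine (congrArg (fun T => T z) h1).trans (h2.trans ?_)
    rw [h3]
    rfl
  rw [← key, ← key]
  exact h _ hf

end Separation

/-! ### The anchor of `χ(u)` from the infinitesimal action. -/

section Infinitesimal

variable {EM : Type*} [NormedAddCommGroup EM] [NormedSpace ℝ EM] [FiniteDimensional ℝ EM]
  {M : Type*} [TopologicalSpace M] [T2Space M] [ChartedSpace EM M] [IsManifold 𝓘(ℝ, EM) ∞ M]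
  {F : Type*} [NormedAddCommGroup F] [NormedSpace ℝ F] [FiniteDimensional ℝ F]
  {E : M → Type*} [TopologicalSpace (TotalSpace F E)] [∀ x, TopologicalSpace (E x)]
  [∀ x, AddCommGroup (E x)] [∀ x, Module ℝ (E x)] [FiberBundle F E] [VectorBundle ℝ F E]
  [ContMDiffVectorBundle ∞ F E 𝓘(ℝ, EM)]
  {C : ExactCourantAlgebroid EM M F E}
  {EG : Type*} [NormedAddCommGroup EG] [NormedSpace ℝ EG]
  {G : Type*} [TopologicalSpace G] [ChartedSpace EG G] [Group G] [LieGroup 𝓘(ℝ, EG) ∞ G]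
  [MulAction G M] [ContMDiffSMul 𝓘(ℝ, EG) 𝓘(ℝ, EM) ∞ G M]
  (A : LiftedAction C EG G)

/-- The curve whose derivative at `1` is the infinitesimal action on sections. -/
noncomputable def LiftedAction.orbitOfSection (e : Cₛ^∞⟮𝓘(ℝ, EM); F, E⟯) (x : M) (g : G) : F :=
  (trivializationAt F E x
    (⟨g • g⁻¹ • x, A.act g (g⁻¹ • x) (e (g⁻¹ • x))⟩ : TotalSpace F E)).2

theorem LiftedAction.orbitOfSection_one (e : Cₛ^∞⟮𝓘(ℝ, EM); F, E⟯) (x : M) :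
    A.orbitOfSection e x 1 = (trivializationAt F E x (⟨x, e x⟩ : TotalSpace F E)).2 := by
  rw [orbitOfSection, A.act_one]
  congr 2
  rw [inv_one, one_smul]

/-- Fibrewise linearity of `𝒜_g` pulls out the scalar, evaluated at `g⁻¹ x`. This moving evaluation
point is what brings the action on `M` into the product rule. -/
theorem LiftedAction.orbitOfSection_smul (e e' : Cₛ^∞⟮𝓘(ℝ, EM); F, E⟯) (f : M → ℝ)
    (h : ∀ x, e' x = f x • e x) (x : M) (g : G) :
    A.orbitOfSection e' x g = f (g⁻¹ • x) • A.orbitOfSection e x g := by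
  rw [orbitOfSection, orbitOfSection, h, map_smul]
  have hb : g • g⁻¹ • x ∈ (trivializationAt F E x).baseSet := by
    rw [smul_inv_smul]
    exact FiberBundle.mem_baseSet_trivializationAt' x
  exact ((trivializationAt F E x).linear ℝ hb).map_smul _ _

theorem contMDiff_inv_smul (x : M) :
    ContMDiff 𝓘(ℝ, EG) 𝓘(ℝ, EM) ∞ fun g : G => g⁻¹ • x :=
  (contMDiff_orbitMap (contMDiff_smul (I := 𝓘(ℝ, EG)) (I' := 𝓘(ℝ, EM)) (n := ∞)) x).comp
    (contMDiff_inv 𝓘(ℝ, EG) ∞)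

theorem LiftedAction.contMDiffAt_orbitOfSection (e : Cₛ^∞⟮𝓘(ℝ, EM); F, E⟯) (x : M) :
    ContMDiffAt 𝓘(ℝ, EG) 𝓘(ℝ, F) ∞ (A.orbitOfSection e x) 1 := by
  have h1 : ContMDiff 𝓘(ℝ, EG) (𝓘(ℝ, EM).prod 𝓘(ℝ, F)) ∞
      (fun g : G => (⟨g⁻¹ • x, e (g⁻¹ • x)⟩ : TotalSpace F E)) :=
    e.contMDiff.comp (contMDiff_inv_smul x)
  have h2 := (A.smooth_act.comp (contMDiff_id.prodMk h1)).contMDiffAt (x := (1 : G))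
  have h3 := (contMDiffAt_totalSpace.1 h2).2
  simpa [Function.comp_def, inv_one, one_smul] using! h3

/-- The anchor of `χ(u)` is the infinitesimal action of `u` on `M`. -/
theorem LiftedAction.anchor_chi (L : DiracStructure C) (u : GroupLieAlgebra 𝓘(ℝ, EG) G) (x : M) :
    (C.anchor x (A.chi u x) : EM) =
      mfderiv 𝓘(ℝ, EG) 𝓘(ℝ, EM) (fun g : G => g⁻¹ • x) 1 u := by
  -- The comparison below needs a global section not vanishing at `x`, and `L` supplies one if `L_x
  -- ≠ 0`. If `L_x = 0`, then `E_x = L_x^⊥ = L_x = 0`, hence `T_xM = 0` and both sides vanish.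
  by_cases hE : ∃ v ∈ L.fibre x, v ≠ 0
  swap
  · push Not at hE
    have h0 : ∀ e : E x, e = 0 := by
      intro e
      refine hE e ?_
      rw [← L.lagrangian x]
      intro n hn
      rw [hE n hn]
      simp
    have h1 : ∀ v : EM, v = 0 := by
      intro v
      obtain ⟨e, rfl⟩ := C.anchor_surjective x v
      rw [h0 e]
      exact map_zero _
    rw [h1 (C.anchor x (A.chi u x))]
    exact (h1 _).symm
  obtain ⟨v, hv, hv0⟩ := hE
  obtain ⟨e, he, -⟩ := L.smooth x v hv
  refine tangent_eq_of_dirDeriv_eq (x := x) fun f hf => ?_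
  let fe : Cₛ^∞⟮𝓘(ℝ, EM); F, E⟯ := ⟨fun y => f y • e y, hf.smul_section e.contMDiff⟩
  have hθ := contMDiff_inv_smul (EG := EG) (EM := EM) (G := G) x
  have hcurve : A.orbitOfSection fe x = (f ∘ fun g : G => g⁻¹ • x) • A.orbitOfSection e x := by
    ext g
    exact A.orbitOfSection_smul e fe f (fun _ => rfl) x g
  have hd := mvfderiv_smul (I := 𝓘(ℝ, EG)) (x := (1 : G)) (a := f ∘ fun g : G => g⁻¹ • x)
    ((hf.comp hθ).mdifferentiable (by simp) 1)
    ((A.contMDiffAt_orbitOfSection e x).mdifferentiableAt (by simp))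
  rw [← hcurve] at hd
  have hd' := congrArg (fun T => T u) hd
  have hchain := mvfderiv_comp_apply_of_eq (I' := 𝓘(ℝ, EG)) (I := 𝓘(ℝ, EM)) (g := f) (y := x)
    (1 : G) (hf.mdifferentiable (by simp) _) (hθ.mdifferentiable (by simp) 1) (by simp) u
  let T := (trivializationAt F E x).continuousLinearEquivAt ℝ x
    (FiberBundle.mem_baseSet_trivializationAt' x)
  -- The product rule for `g ↦ 𝒜_g(f e)(x)`; set against `C.leibniz`, the terms in `[χ(u), e]`
  -- cancel and the coefficients of `e(x) ≠ 0` must agree.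
  have h1 : T (C.bracket (A.chi u) fe x) = f x • T (C.bracket (A.chi u) e x) +
      dirDeriv f x (mfderiv 𝓘(ℝ, EG) 𝓘(ℝ, EM) (fun g : G => g⁻¹ • x) 1 u) • T (e x) := by
    refine (A.infinitesimal u fe x).symm.trans (hd'.trans ?_)
    have h3 : (f ∘ fun g : G => g⁻¹ • x) 1 = f x := by simp
    have h4 : mvfderiv 𝓘(ℝ, EG) (A.orbitOfSection e x) 1 u = T (C.bracket (A.chi u) e x) :=
      A.infinitesimal u e x
    have h5 : A.orbitOfSection e x 1 = T (e x) := A.orbitOfSection_one e x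
    simp only [add_apply, smul_apply,
      ContinuousLinearMap.smulRight_apply]
    rw [h3, h4, h5, hchain]
    rfl
  have h2 := C.leibniz (A.chi u) e fe f hf (fun _ => rfl) x
  rw [h2, map_add, map_smul, map_smul, add_right_inj] at h1
  have hT : T (e x) ≠ 0 := by
    rw [he]
    simpa using hv0
  exact smul_left_injective ℝ hT h1

end Infinitesimal

/-! ### The vectors `p(χ(u))` span the kernel of `dq`. -/

section Vertical

variable {EM : Type*} [NormedAddCommGroup EM] [NormedSpace ℝ EM]
  {M : Type*} [TopologicalSpace M] [ChartedSpace EM M] [IsManifold 𝓘(ℝ, EM) ∞ M]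
  {F : Type*} [NormedAddCommGroup F] [NormedSpace ℝ F] [FiniteDimensional ℝ F]
  {E : M → Type*} [TopologicalSpace (TotalSpace F E)] [∀ x, TopologicalSpace (E x)]
  [∀ x, AddCommGroup (E x)] [∀ x, Module ℝ (E x)] [FiberBundle F E] [VectorBundle ℝ F E]
  {C : ExactCourantAlgebroid EM M F E}
  {EG : Type*} [NormedAddCommGroup EG] [NormedSpace ℝ EG]
  {G : Type*} [TopologicalSpace G] [ChartedSpace EG G] [Group G] [LieGroup 𝓘(ℝ, EG) ∞ G]
  [MulAction G M]
  {EN : Type*} [NormedAddCommGroup EN] [NormedSpace ℝ EN]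
  {N : Type*} [TopologicalSpace N] [ChartedSpace EN N] [MulAction G N]
  {ER : Type*} [NormedAddCommGroup ER] [NormedSpace ℝ ER] [ChartedSpace ER (MRed G N)]
  (A : LiftedAction C EG G) (S : FreeInvariantSubmanifold EM M G EG EN N)

theorem quot_smul (g : G) (x : N) : quot G N (g • x) = quot G N x :=
  Quotient.sound' ⟨g, rfl⟩

theorem quot_eq_iff {x y : N} : quot G N y = quot G N x ↔ ∃ g : G, y = g • x :=
  ⟨fun h => (Quotient.exact h).imp fun _ hg => hg.symm, fun ⟨g, hg⟩ => hg ▸ quot_smul g x⟩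

/-- The differential `d(g·)_x : T_xN → T_{gx}N` of the action on `N`. -/
noncomputable def dsmul (EN : Type*) [NormedAddCommGroup EN] [NormedSpace ℝ EN] [ChartedSpace EN N]
    (g : G) (x : N) : TangentSpace 𝓘(ℝ, EN) x →L[ℝ] TangentSpace 𝓘(ℝ, EN) (g • x) :=
  mfderiv 𝓘(ℝ, EN) 𝓘(ℝ, EN) (fun y : N => g • y) x

/-- Differentiate `q ∘ (g·) = q`. The equation is read in `ER` because `q(gx)` and `q(x)` are equal
only propositionally. -/
theorem dquot_dsmul (S : FreeInvariantSubmanifold EM M G EG EN N)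
    (hq : IsQuotientManifold G EN N ER) (g : G) (x : N) (X : TangentSpace 𝓘(ℝ, EN) x) :
    (dquot G EN ER (g • x) (dsmul EN g x X) : ER) = dquot G EN ER x X := by
  have h1 : quot G N ∘ (fun y : N => g • y) = quot G N := funext fun y => quot_smul g y
  have h2 := mfderiv_comp_apply (I' := 𝓘(ℝ, EN)) (I'' := 𝓘(ℝ, ER)) (g := quot G N) x
    (hq.1.mdifferentiable (by simp) _)
    ((contMDiff_const_smul_of_smul S.smooth_smul g).mdifferentiable (by simp) x) X
  refine h2.symm.trans ?_
  rw [h1]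
  rfl

theorem FreeInvariantSubmanifold.dincl_dsmul
    [ContMDiffSMul 𝓘(ℝ, EG) 𝓘(ℝ, EM) ∞ G M] (g : G) (x : N) (X : TangentSpace 𝓘(ℝ, EN) x) :
    (S.dincl (g • x) (dsmul EN g x X) : EM) =
      mfderiv 𝓘(ℝ, EM) 𝓘(ℝ, EM) (fun y : M => g • y) (S.incl x) (S.dincl x X) := by
  have h1 : S.incl ∘ (fun y : N => g • y) = (fun y : M => g • y) ∘ S.incl :=
    funext fun y => S.equivariant g y
  have h2 := mfderiv_comp_apply (I' := 𝓘(ℝ, EN)) (I'' := 𝓘(ℝ, EM)) (g := S.incl) x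
    (S.smooth.mdifferentiable (by simp) _)
    ((contMDiff_const_smul_of_smul S.smooth_smul g).mdifferentiable (by simp) x) X
  have h3 := mfderiv_comp_apply (I' := 𝓘(ℝ, EM)) (I'' := 𝓘(ℝ, EM)) (g := fun y : M => g • y) x
    ((contMDiff_const_smul_of_smul (contMDiff_smul (I := 𝓘(ℝ, EG)) (I' := 𝓘(ℝ, EM)) (n := ∞))
      g).mdifferentiable (by simp) _) (S.smooth.mdifferentiable (by simp) x) X
  refine h2.symm.trans ?_
  rw [h1]
  exact h3

theorem contMDiff_inv_smul_submanifold (S : FreeInvariantSubmanifold EM M G EG EN N) (x : N) :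
    ContMDiff 𝓘(ℝ, EG) 𝓘(ℝ, EN) ∞ fun g : G => g⁻¹ • x :=
  (contMDiff_orbitMap S.smooth_smul x).comp (contMDiff_inv 𝓘(ℝ, EG) ∞)

variable [FiniteDimensional ℝ EM] [T2Space M] [FiniteDimensional ℝ EG]
  [ContMDiffVectorBundle ∞ F E 𝓘(ℝ, EM)] [ContMDiffSMul 𝓘(ℝ, EG) 𝓘(ℝ, EM) ∞ G M]

/-- Differentiate `j(g⁻¹ x) = g⁻¹ j(x)` at `1`. The inverse is the convention of the action on
sections, inherited from `LiftedAction.anchor_chi`. -/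
theorem dincl_infinitesimal (L : DiracStructure C) (u : GroupLieAlgebra 𝓘(ℝ, EG) G) (x : N) :
    (S.dincl x (mfderiv 𝓘(ℝ, EG) 𝓘(ℝ, EN) (fun g : G => g⁻¹ • x) 1 u : EN) : EM) =
      C.anchor _ (A.chi u (S.incl x)) := by
  have h1 : S.incl ∘ (fun g : G => g⁻¹ • x) = fun g : G => g⁻¹ • S.incl x :=
    funext fun g => S.equivariant g⁻¹ x
  have h2 := mfderiv_comp_apply_of_eq (I' := 𝓘(ℝ, EN)) (I'' := 𝓘(ℝ, EM)) (g := S.incl) (y := x)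
    (1 : G) (S.smooth.mdifferentiable (by simp) _)
    ((contMDiff_inv_smul_submanifold S x).mdifferentiable (by simp) 1) (by simp) u
  refine Eq.trans ?_ (A.anchor_chi L u (S.incl x)).symm
  rw [← h1]
  exact h2.symm

/-- `p(χ(u))` is tangent to the fibres of `q`. -/
theorem exists_mem_ker_dquot (hq : IsQuotientManifold G EN N ER) (L : DiracStructure C)
    (u : GroupLieAlgebra 𝓘(ℝ, EG) G) (x : N) :
    ∃ X, dquot G EN ER x X = 0 ∧ S.dincl x X = C.anchor _ (A.chi u (S.incl x)) := by
  refine ⟨_, ?_, dincl_infinitesimal A S L u x⟩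
  have h1 : quot G N ∘ (fun g : G => g⁻¹ • x) = fun _ => quot G N x :=
    funext fun g => quot_smul g⁻¹ x
  have h2 := mfderiv_comp_apply_of_eq (I' := 𝓘(ℝ, EN)) (I'' := 𝓘(ℝ, ER)) (g := quot G N) (y := x)
    (1 : G) (hq.1.mdifferentiable (by simp) _)
    ((contMDiff_inv_smul_submanifold S x).mdifferentiable (by simp) 1) (by simp) u
  refine h2.symm.trans ?_
  rw [h1, mfderiv_const]
  rfl

/-- The fibres of `q` are spanned by the vectors `p(χ(u))`. -/
theorem exists_anchor_chi_eq [CompactSpace G] [FiniteDimensional ℝ EN] [T2Space N]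
    [IsManifold 𝓘(ℝ, EN) ∞ N] [FiniteDimensional ℝ ER] [IsManifold 𝓘(ℝ, ER) ∞ (MRed G N)]
    (hq : IsQuotientManifold G EN N ER) (L : DiracStructure C)
    (x : N) (X : TangentSpace 𝓘(ℝ, EN) x) (hX : dquot G EN ER x X = 0) :
    ∃ u, C.anchor _ (A.chi u (S.incl x)) = S.dincl x X := by
  obtain ⟨u, hu⟩ := mem_range_mfderiv_orbitMap S.smooth_smul S.free hq x X hX
  have h1 : (fun g : G => g⁻¹ • x) ∘ (fun g : G => g⁻¹) = fun g : G => g • x :=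
    funext fun g => by simp
  have h2 := mfderiv_comp_apply_of_eq (I' := 𝓘(ℝ, EG)) (I'' := 𝓘(ℝ, EN))
    (g := fun g : G => g⁻¹ • x) (y := 1)
    (1 : G) ((contMDiff_inv_smul_submanifold S x).mdifferentiable (by simp) _)
    ((contMDiff_inv 𝓘(ℝ, EG) ∞).mdifferentiable (by simp) (1 : G)) (by simp) u
  rw [h1] at h2
  -- The derivative of inversion converts the orbit map `g ↦ g x` into the map `g ↦ g⁻¹ x` that
  -- matches `χ`.
  refine ⟨(mfderiv 𝓘(ℝ, EG) 𝓘(ℝ, EG) (fun g : G => g⁻¹) 1 u : EG), ?_⟩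
  refine (dincl_infinitesimal A S L _ x).symm.trans ?_
  exact congrArg (S.dincl x) (h2.symm.trans hu)

end Vertical

/-! ### Linear algebra: coordinates on `K_x^⊥ / K_x`. -/

section Coordinates

variable {EM : Type*} [NormedAddCommGroup EM] [NormedSpace ℝ EM]
  {M : Type*} [TopologicalSpace M] [ChartedSpace EM M] [IsManifold 𝓘(ℝ, EM) ∞ M]
  {F : Type*} [NormedAddCommGroup F] [NormedSpace ℝ F] [FiniteDimensional ℝ F]
  {E : M → Type*} [TopologicalSpace (TotalSpace F E)] [∀ x, TopologicalSpace (E x)]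
  [∀ x, AddCommGroup (E x)] [∀ x, Module ℝ (E x)] [FiberBundle F E] [VectorBundle ℝ F E]
  {C : ExactCourantAlgebroid EM M F E}
  {EG : Type*} [NormedAddCommGroup EG] [NormedSpace ℝ EG]
  {G : Type*} [TopologicalSpace G] [ChartedSpace EG G] [Group G] [LieGroup 𝓘(ℝ, EG) ∞ G]
  [MulAction G M]
  {EN : Type*} [NormedAddCommGroup EN] [NormedSpace ℝ EN]
  {N : Type*} [TopologicalSpace N] [ChartedSpace EN N] [MulAction G N]
  {ER : Type*} [NormedAddCommGroup ER] [NormedSpace ℝ ER] [ChartedSpace ER (MRed G N)]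
  {A : LiftedAction C EG G} {S : FreeInvariantSubmanifold EM M G EG EN N}
  {nab : IsotropicSplitting C}

theorem anchor_coanchor (m : M) (β : Cotangent (EM := EM) m) :
    C.anchor m (coanchor C m β) = 0 :=
  (C.exact_middle m _).2 ⟨β, pairing_coanchor C m β⟩

theorem IsotropicSplitting.anchor_add_coanchor (nab : IsotropicSplitting C) (m : M)
    (X : TangentSpace 𝓘(ℝ, EM) m) (β : Cotangent (EM := EM) m) :
    C.anchor m (nab.toFun m X + coanchor C m β) = X := by
  rw [map_add, nab.anchor_toFun, anchor_coanchor, add_zero]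

/-- In the splitting `E ≅ TM ⊕ T^*M` the pairing is the canonical one. -/
theorem IsotropicSplitting.pairing_add_coanchor (nab : IsotropicSplitting C) (m : M)
    (X X' : TangentSpace 𝓘(ℝ, EM) m) (β β' : Cotangent (EM := EM) m) :
    C.pairing m (nab.toFun m X + coanchor C m β) (nab.toFun m X' + coanchor C m β') =
      β X' + β' X := by
  rw [map_add (C.pairing m), LinearMap.add_apply, pairing_coanchor, nab.anchor_add_coanchor,
    map_add, nab.isotropic, C.pairing_symm, pairing_coanchor, nab.anchor_toFun]
  ring

theorem coanchor_injective (m : M) : Function.Injective (coanchor C m) := by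
  refine (injective_iff_map_eq_zero _).2 fun β h => ?_
  ext X
  obtain ⟨e, rfl⟩ := C.anchor_surjective m X
  rw [← pairing_coanchor, h]
  simp

variable (A S ER) in
/-- The vectors `p(χ(u))`, `u ∈ 𝔤`, are tangent to `N` and span the kernel of `dq`. -/
def IsVerticalSpan (x : N) : Prop :=
  (∀ u, ∃ X, dquot G EN ER x X = 0 ∧ S.dincl x X = C.anchor _ (A.chi u (S.incl x))) ∧
    ∀ X, dquot G EN ER x X = 0 → ∃ u, C.anchor _ (A.chi u (S.incl x)) = S.dincl x X

variable (S nab) in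
/-- `v = Y + η` are coordinates of `e ∈ E_x` if `e = ∇X + p^*β` with `X ∈ T_xN`, `dq_x X = Y` and
`dj_x^* β = dq_x^* η`. -/
def HasCoords (x : N) (e : E (S.incl x)) (v : ER × Module.Dual ℝ ER) : Prop :=
  ∃ (X : TangentSpace 𝓘(ℝ, EN) x) (β : Cotangent (EM := EM) (S.incl x)),
    e = nab.toFun _ (S.dincl x X) + coanchor C _ β ∧ dquot G EN ER x X = v.1 ∧
      ∀ Z : TangentSpace 𝓘(ℝ, EN) x, β (S.dincl x Z) = v.2 (dquot G EN ER x Z)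

theorem HasCoords.add {x : N} {e e' : E (S.incl x)} {v v' : ER × Module.Dual ℝ ER}
    (h : HasCoords S nab x e v) (h' : HasCoords S nab x e' v') :
    HasCoords S nab x (e + e') (v + v') := by
  obtain ⟨X, β, rfl, hX, hβ⟩ := h
  obtain ⟨X', β', rfl, hX', hβ'⟩ := h'
  refine ⟨X + X', β + β', ?_, ?_, fun Z => ?_⟩
  · simp only [map_add]
    abel
  · rw [map_add, hX, hX']
    rfl
  · rw [LinearMap.add_apply, hβ, hβ']
    rfl

theorem HasCoords.smul {x : N} {e : E (S.incl x)} {v : ER × Module.Dual ℝ ER} (r : ℝ)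
    (h : HasCoords S nab x e v) : HasCoords S nab x (r • e) (r • v) := by
  obtain ⟨X, β, rfl, hX, hβ⟩ := h
  refine ⟨r • X, r • β, ?_, ?_, fun Z => ?_⟩
  · simp only [map_smul, smul_add]
  · rw [map_smul, hX]
    rfl
  · rw [LinearMap.smul_apply, hβ]
    rfl

theorem HasCoords.sub {x : N} {e e' : E (S.incl x)} {v v' : ER × Module.Dual ℝ ER}
    (h : HasCoords S nab x e v) (h' : HasCoords S nab x e' v') :
    HasCoords S nab x (e - e') (v - v') := by
  have := h.add (h'.smul (-1))
  rwa [neg_one_smul ℝ e', neg_one_smul ℝ v', ← sub_eq_add_neg, ← sub_eq_add_neg] at this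

theorem HasCoords.zero (x : N) : HasCoords S nab x 0 (0 : ER × Module.Dual ℝ ER) :=
  ⟨0, 0, by simp, map_zero _, fun _ => rfl⟩

theorem HasCoords.pairing {x : N} {e e' : E (S.incl x)} {v v' : ER × Module.Dual ℝ ER}
    (h : HasCoords S nab x e v) (h' : HasCoords S nab x e' v') :
    C.pairing _ e e' = v.2 v'.1 + v'.2 v.1 := by
  obtain ⟨X, β, rfl, hX, hβ⟩ := h
  obtain ⟨X', β', rfl, hX', hβ'⟩ := h'
  rw [nab.pairing_add_coanchor, hβ, hβ', hX, hX']

/-- Surjectivity of `dq_x` lifts the vector, and injectivity of `dj_x` lets the covector `dq_x^*η`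
on `T_xN` extend to `T_xM`. -/
theorem exists_hasCoords (hq : IsQuotientManifold G EN N ER) (x : N)
    (v : ER × Module.Dual ℝ ER) : ∃ e, HasCoords S nab x e v := by
  obtain ⟨X, hX⟩ := hq.2 x v.1
  let η : Cotangent (EM := EN) x := (show Module.Dual ℝ (TangentSpace 𝓘(ℝ, ER) (quot G N x)) from
    v.2) ∘ₗ dquot G EN ER x
  obtain ⟨β, hβ⟩ := LinearMap.dualMap_surjective_of_injective
    (f := S.dincl x) (S.immersion x) η
  exact ⟨_, X, β, rfl, hX, fun Z => LinearMap.congr_fun hβ Z⟩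

/-- Together with `HasCoords.sub` this makes the coordinates of an element unique. -/
theorem HasCoords.eq_zero (hq : IsQuotientManifold G EN N ER) {x : N}
    {v : ER × Module.Dual ℝ ER} (h : HasCoords S nab x 0 v) : v = 0 := by
  obtain ⟨X, β, h0, hX, hβ⟩ := h
  have h1 := congrArg (C.anchor _) h0
  rw [nab.anchor_add_coanchor, map_zero] at h1
  have h2 : X = 0 := S.immersion x (h1.symm.trans (map_zero (S.dincl x)).symm)
  rw [← h1, map_zero, zero_add] at h0
  have h3 : β = 0 := coanchor_injective _ (h0.symm.trans (map_zero _).symm)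
  refine Prod.ext ?_ (LinearMap.ext fun Y => ?_)
  · rw [← hX, h2]
    exact map_zero _
  · obtain ⟨Z, rfl⟩ := hq.2 x Y
    refine (hβ Z).symm.trans ?_
    rw [h3]
    rfl

/-- Writing `X = p(χ(u))` gives `e = χ(u) + p^*(β - ξ_∇(u))`, and both `β` and `ξ_∇(u)` vanish on
`T_xN`. -/
theorem mem_isoK_of_ker (hnab : nab.IsAdmissible A S) {x : N} (hx : IsVerticalSpan ER A S x)
    {e : E (S.incl x)} (h : HasCoords S nab x e (0 : ER × Module.Dual ℝ ER)) :
    e ∈ isoK A S x := by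
  obtain ⟨X, β, rfl, hX, hβ⟩ := h
  obtain ⟨u, hu⟩ := hx.2 X hX
  have h1 := nab.decomposition _ (A.chi u (S.incl x))
  have h2 : nab.toFun _ (S.dincl x X) + coanchor C _ β =
      A.chi u (S.incl x) + coanchor C _ (β - nab.momentForm A u (S.incl x)) := by
    rw [hu] at h1
    conv_rhs => rw [← h1]
    rw [map_sub]
    simp only [IsotropicSplitting.momentForm]
    abel
  rw [h2]
  refine Submodule.add_mem_sup (Submodule.subset_span ⟨u, rfl⟩) ⟨_, ?_, rfl⟩
  refine (Submodule.mem_dualAnnihilator _).2 ?_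
  rintro _ ⟨Z, rfl⟩
  rw [LinearMap.sub_apply, hβ]
  have h3 := LinearMap.congr_fun (hnab.2 u x) Z
  rw [LinearMap.comp_apply] at h3
  rw [h3]
  exact sub_self (0 : ℝ)

theorem hasCoords_zero_iff (hnab : nab.IsAdmissible A S) {x : N} (hx : IsVerticalSpan ER A S x)
    {e : E (S.incl x)} :
    HasCoords S nab x e (0 : ER × Module.Dual ℝ ER) ↔ e ∈ isoK A S x := by
  refine ⟨mem_isoK_of_ker hnab hx, fun h => ?_⟩
  obtain ⟨k, hk, c, ⟨γ, hγ, rfl⟩, rfl⟩ := Submodule.mem_sup.1 h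
  rw [← add_zero (0 : ER × Module.Dual ℝ ER)]
  refine HasCoords.add ?_ ?_
  · clear h
    induction hk using Submodule.span_induction with
    | mem k hk =>
      obtain ⟨u, rfl⟩ := hk
      obtain ⟨X, hX, hXu⟩ := hx.1 u
      refine ⟨X, nab.momentForm A u (S.incl x), ?_, hX, fun Z => ?_⟩
      · rw [hXu]
        exact (nab.decomposition _ _).symm
      · exact LinearMap.congr_fun (hnab.2 u x) Z
    | zero => exact .zero x
    | add a b _ _ ha hb =>
      rw [← add_zero (0 : ER × Module.Dual ℝ ER)]
      exact ha.add hb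
    | smul r a _ ha =>
      rw [← smul_zero r]
      exact ha.smul r
  · refine ⟨0, γ, by simp, map_zero _, fun Z => ?_⟩
    exact (Submodule.mem_dualAnnihilator _).1 hγ _ ⟨Z, rfl⟩

/-- The pairing depends only on coordinates, and elements of `K_x` have coordinates zero. -/
theorem HasCoords.mem_isoKPerp (hnab : nab.IsAdmissible A S) {x : N}
    (hx : IsVerticalSpan ER A S x) {e : E (S.incl x)} {v : ER × Module.Dual ℝ ER}
    (h : HasCoords S nab x e v) : e ∈ isoKPerp A S x := by
  intro k hk
  have := ((hasCoords_zero_iff (ER := ER) hnab hx).2 hk).pairing h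
  simpa using this

/-- Orthogonality to `p^*(Ann T_xN)` makes the anchor tangent to `N`, by double annihilation.
Orthogonality to `∇Z` for `Z ∈ ker dq_x` makes the covector, restricted to `T_xN`, factor through
`dq_x`. -/
theorem exists_coords_of_mem_isoKPerp (hnab : nab.IsAdmissible A S) {x : N}
    (hx : IsVerticalSpan ER A S x) {e : E (S.incl x)} (he : e ∈ isoKPerp A S x) :
    ∃ v : ER × Module.Dual ℝ ER, HasCoords S nab x e v := by
  have h1 : C.anchor _ e ∈ LinearMap.range (S.dincl x) := by
    rw [← Subspace.dualAnnihilator_dualCoannihilator_eq (W := LinearMap.range (S.dincl x)),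
      Submodule.mem_dualCoannihilator]
    intro α hα
    have := he (coanchor C _ α) (Submodule.mem_sup_right ⟨α, hα, rfl⟩)
    rw [← pairing_coanchor]
    exact this
  obtain ⟨X, hX⟩ := h1
  have h2 : nab.covector _ e ∘ₗ S.dincl x ∈
      LinearMap.range (dquot G EN ER x).dualMap := by
    rw [LinearMap.range_dualMap_eq_dualAnnihilator_ker, Submodule.mem_dualAnnihilator]
    intro Z hZ
    have h3 : nab.toFun _ (S.dincl x Z) ∈ isoK A S x :=
      mem_isoK_of_ker (ER := ER) hnab hx ⟨Z, 0, by simp, hZ, fun _ => rfl⟩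
    refine (C.pairing_symm _ _ _).trans ?_
    exact he _ h3
  obtain ⟨η, hη⟩ := h2
  refine ⟨(dquot G EN ER x X, η), X, nab.covector _ e, ?_, rfl, fun Z => ?_⟩
  · rw [hX, nab.decomposition]
  · exact (LinearMap.congr_fun hη Z).symm

theorem HasCoords.cls_eq_iff (hq : IsQuotientManifold G EN N ER) (hnab : nab.IsAdmissible A S)
    {x : N} (hx : IsVerticalSpan ER A S x) {e e' : isoKPerp A S x} {v v' : ER × Module.Dual ℝ ER}
    (h : HasCoords S nab x (e : E (S.incl x)) v)
    (h' : HasCoords S nab x (e' : E (S.incl x)) v') :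
    cls A S x e = cls A S x e' ↔ v = v' := by
  have h1 : cls A S x e = cls A S x e' ↔ (e : E (S.incl x)) - e' ∈ isoK A S x :=
    Submodule.Quotient.eq _
  rw [h1, ← hasCoords_zero_iff (ER := ER) hnab hx]
  constructor
  · intro h0
    have := (h.sub h').sub h0
    rw [sub_self, sub_zero] at this
    exact sub_eq_zero.1 (this.eq_zero hq)
  · rintro rfl
    simpa using h.sub h'

end Coordinates

/-! ### Orbits in `K^⊥ / K` and the structures on `E_red`, in coordinates. -/

section ReducedBundle

variable {EM : Type*} [NormedAddCommGroup EM] [NormedSpace ℝ EM]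
  {M : Type*} [TopologicalSpace M] [ChartedSpace EM M] [IsManifold 𝓘(ℝ, EM) ∞ M]
  {F : Type*} [NormedAddCommGroup F] [NormedSpace ℝ F] [FiniteDimensional ℝ F]
  {E : M → Type*} [TopologicalSpace (TotalSpace F E)] [∀ x, TopologicalSpace (E x)]
  [∀ x, AddCommGroup (E x)] [∀ x, Module ℝ (E x)] [FiberBundle F E] [VectorBundle ℝ F E]
  {C : ExactCourantAlgebroid EM M F E}
  {EG : Type*} [NormedAddCommGroup EG] [NormedSpace ℝ EG]
  {G : Type*} [TopologicalSpace G] [ChartedSpace EG G] [Group G] [LieGroup 𝓘(ℝ, EG) ∞ G]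
  [MulAction G M]
  {EN : Type*} [NormedAddCommGroup EN] [NormedSpace ℝ EN]
  {N : Type*} [TopologicalSpace N] [ChartedSpace EN N] [MulAction G N]
  {ER : Type*} [NormedAddCommGroup ER] [NormedSpace ℝ ER] [ChartedSpace ER (MRed G N)]
  {A : LiftedAction C EG G} {S : FreeInvariantSubmanifold EM M G EG EN N}
  {nab : IsotropicSplitting C}


/-- The automorphism preserves `ker p`, so exactness yields `β'`; invariance of the pairing
identifies it as the transported covector. -/
theorem LiftedAction.act_coanchor (A : LiftedAction C EG G) (g : G) (m : M)
    (β : Cotangent (EM := EM) m) :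
    ∃ β' : Cotangent (EM := EM) (g • m), A.act g m (coanchor C m β) = coanchor C (g • m) β' ∧
      ∀ Z, β' (mfderiv 𝓘(ℝ, EM) 𝓘(ℝ, EM) (fun y : M => g • y) m Z) = β Z := by
  obtain ⟨β', hβ'⟩ := (C.exact_middle (g • m) (A.act g m (coanchor C m β))).1 (by
    rw [A.act_anchor, anchor_coanchor]
    exact map_zero _)
  refine ⟨β', ?_, fun Z => ?_⟩
  · refine sub_eq_zero.1 ((C.pairing_nondegenerate (g • m)).1 _ fun e => ?_)
    rw [map_sub, LinearMap.sub_apply, hβ', pairing_coanchor, sub_self]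
  · obtain ⟨e, rfl⟩ := C.anchor_surjective m Z
    rw [← A.act_anchor, ← hβ', A.act_pairing, pairing_coanchor]

/-- The free endpoint `m'` allows `j(gx)` to be used in place of `g j(x)`, to which it is only
propositionally equal. -/
theorem IsotropicSplitting.IsInvariant.onTotal_eq {A : LiftedAction C EG G}
    (hnab : nab.IsInvariant A) (g : G) (m m' : M) (h : m' = g • m)
    (X : TangentSpace 𝓘(ℝ, EM) m) (β : Cotangent (EM := EM) m) :
    ∃ β' : Cotangent (EM := EM) m',
      (⟨m', nab.toFun m' (mfderiv 𝓘(ℝ, EM) 𝓘(ℝ, EM) (fun y : M => g • y) m X : EM) +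
        coanchor C m' β'⟩ : TotalSpace F E) =
          A.onTotal g ⟨m, nab.toFun m X + coanchor C m β⟩ ∧
      ∀ Z, β' (mfderiv 𝓘(ℝ, EM) 𝓘(ℝ, EM) (fun y : M => g • y) m Z : EM) = β Z := by
  subst h
  obtain ⟨β', h1, h2⟩ := A.act_coanchor g m β
  refine ⟨β', ?_, h2⟩
  rw [LiftedAction.onTotal, map_add, h1, hnab]

theorem dsmul_surjective (S : FreeInvariantSubmanifold EM M G EG EN N) (g : G) (x : N) :
    Function.Surjective (dsmul EN g x) := by
  intro W
  have h1 : (fun y : N => g • y) ∘ (fun y : N => g⁻¹ • y) = id := funext fun y => by simp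
  have h2 := mfderiv_comp_apply_of_eq (I' := 𝓘(ℝ, EN)) (I'' := 𝓘(ℝ, EN))
    (g := fun y : N => g • y) (y := x) (g • x)
    ((contMDiff_const_smul_of_smul S.smooth_smul g).mdifferentiable (by simp) _)
    ((contMDiff_const_smul_of_smul S.smooth_smul g⁻¹).mdifferentiable (by simp) _) (by simp) W
  refine ⟨(mfderiv 𝓘(ℝ, EN) 𝓘(ℝ, EN) (fun y : N => g⁻¹ • y) (g • x) W : EN), ?_⟩
  refine h2.symm.trans ?_
  rw [h1, mfderiv_id]
  rfl

variable [ContMDiffSMul 𝓘(ℝ, EG) 𝓘(ℝ, EM) ∞ G M]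

/-- The reduced coordinates are invariant under the lifted action. -/
theorem HasCoords.exists_smul (hq : IsQuotientManifold G EN N ER) (hnab : nab.IsInvariant A)
    (g : G) {x : N} {e : E (S.incl x)} {v : ER × Module.Dual ℝ ER}
    (h : HasCoords S nab x e v) :
    ∃ e' : E (S.incl (g • x)), (⟨S.incl (g • x), e'⟩ : TotalSpace F E) =
      A.onTotal g ⟨S.incl x, e⟩ ∧ HasCoords S nab (g • x) e' v := by
  obtain ⟨X, β, rfl, hX, hβ⟩ := h
  obtain ⟨β', h1, h2⟩ := hnab.onTotal_eq g (S.incl x) (S.incl (g • x)) (S.equivariant g x)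
    (S.dincl x X) β
  refine ⟨_, h1, dsmul EN g x X, β', ?_, ?_, fun W => ?_⟩
  · congr 2
    exact (S.dincl_dsmul g x X).symm
  · exact (dquot_dsmul S hq g x X).trans hX
  · obtain ⟨Z, rfl⟩ := dsmul_surjective S g x W
    refine (congrArg β' (S.dincl_dsmul g x Z)).trans ?_
    refine (h2 _).trans ((hβ Z).trans ?_)
    exact congrArg v.2 (dquot_dsmul S hq g x Z).symm

variable (A S nab) in
/-- The elements of `K^⊥ / K` over `y` with coordinates `v`. -/
def coordSet (y : MRed G N) (v : ER × Module.Dual ℝ ER) : Set (PerpModKTotal A S) :=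
  {a | quot G N a.1 = y ∧ ∃ e : isoKPerp A S a.1, cls A S a.1 e = a.2 ∧
    HasCoords S nab a.1 (e : E (S.incl a.1)) v}

/-- The action preserves coordinates and is transitive on the fibres of `q`, and at each point the
coordinates determine the class. -/
theorem orbitOf_eq_coordSet (hq : IsQuotientManifold G EN N ER) (hnab : nab.IsAdmissible A S)
    (hv : ∀ x, IsVerticalSpan ER A S x) {x : N} {e : isoKPerp A S x}
    {v : ER × Module.Dual ℝ ER} (h : HasCoords S nab x (e : E (S.incl x)) v) :
    orbitOf A S ⟨x, cls A S x e⟩ = coordSet A S nab (quot G N x) v := by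
  ext ⟨x', b⟩
  constructor
  · rintro ⟨g, (e₁ : isoKPerp A S x), (e₂ : isoKPerp A S x'), h1,
      (rfl : cls A S x' e₂ = b), rfl, h3⟩
    obtain ⟨v₁, hv₁⟩ := exists_coords_of_mem_isoKPerp (ER := ER) hnab (hv x) e₁.2
    obtain rfl := (hv₁.cls_eq_iff hq hnab (hv x) h).1 h1
    obtain ⟨e', he', hc⟩ := hv₁.exists_smul hq hnab.1 g
    refine ⟨quot_smul g x, e₂, rfl, ?_⟩
    have := h3.trans he'.symm
    rw [TotalSpace.mk.injEq] at this
    rwa [eq_of_heq this.2]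
  · rintro ⟨h1, (e₂ : isoKPerp A S x'), (rfl : cls A S x' e₂ = b), h2⟩
    obtain ⟨g, rfl⟩ := quot_eq_iff.1 h1
    obtain ⟨e', he', hc⟩ := h.exists_smul hq hnab.1 g
    exact ⟨g, e, ⟨e', hc.mem_isoKPerp hnab (hv _)⟩, rfl,
      (HasCoords.cls_eq_iff hq hnab (hv _) hc h2).2 rfl, rfl, he'⟩

theorem coordSet_nonempty (hq : IsQuotientManifold G EN N ER) (hnab : nab.IsAdmissible A S)
    (hv : ∀ x, IsVerticalSpan ER A S x) (x : N) (v : ER × Module.Dual ℝ ER) :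
    ∃ e : isoKPerp A S x, HasCoords S nab x (e : E (S.incl x)) v ∧
      (⟨x, cls A S x e⟩ : PerpModKTotal A S) ∈ coordSet A S nab (quot G N x) v := by
  obtain ⟨e, he⟩ := exists_hasCoords (S := S) (nab := nab) hq x v
  exact ⟨⟨e, he.mem_isoKPerp hnab (hv x)⟩, he, rfl, _, rfl, he⟩

theorem coordSet_injective (hq : IsQuotientManifold G EN N ER) (hnab : nab.IsAdmissible A S)
    (hv : ∀ x, IsVerticalSpan ER A S x) (x : N) :
    Function.Injective (coordSet (ER := ER) A S nab (quot G N x)) := by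
  intro v w h
  obtain ⟨e, he, hmem⟩ := coordSet_nonempty hq hnab hv x v
  rw [h] at hmem
  obtain ⟨-, e', h1, h2⟩ := hmem
  exact (he.cls_eq_iff hq hnab (hv x) h2).1 h1.symm

theorem addRed_coordSet (hq : IsQuotientManifold G EN N ER) (hnab : nab.IsAdmissible A S)
    (hv : ∀ x, IsVerticalSpan ER A S x) (y : MRed G N) (v w : ER × Module.Dual ℝ ER) :
    addRed A S (coordSet A S nab y v) (coordSet A S nab y w) = coordSet A S nab y (v + w) := by
  ext ⟨x, c⟩
  constructor
  · rintro ⟨a, b, ⟨hy, (e : isoKPerp A S x), (rfl : cls A S x e = a), he⟩,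
      ⟨-, (e' : isoKPerp A S x), (rfl : cls A S x e' = b), he'⟩, hc⟩
    exact ⟨hy, e + e', (map_add _ _ _).trans hc.symm, he.add he'⟩
  · rintro ⟨rfl, (e : isoKPerp A S x), (rfl : cls A S x e = c), he⟩
    obtain ⟨e₁, h1, hm1⟩ := coordSet_nonempty hq hnab hv x v
    obtain ⟨e₂, h2, hm2⟩ := coordSet_nonempty hq hnab hv x w
    refine ⟨_, _, hm1, hm2, ?_⟩
    rw [← map_add]
    exact (he.cls_eq_iff hq hnab (hv x) (e' := e₁ + e₂) (h1.add h2)).2 rfl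

theorem nablaRed_eq_coordSet (hq : IsQuotientManifold G EN N ER) (hnab : nab.IsAdmissible A S)
    (hv : ∀ x, IsVerticalSpan ER A S x) (y : MRed G N) (Y : TangentSpace 𝓘(ℝ, ER) y) :
    nablaRed A S nab ⟨y, Y⟩ = coordSet (ER := ER) A S nab y (Y, 0) := by
  ext ⟨x, b⟩
  constructor
  · rintro ⟨(e : isoKPerp A S x), X, (rfl : cls A S x e = b), he, hY⟩
    rw [TotalSpace.mk.injEq] at hY
    obtain ⟨rfl, hY⟩ := hY
    obtain rfl := eq_of_heq hY
    exact ⟨rfl, e, rfl, X, 0, by rw [he, map_zero, add_zero], rfl, fun _ => rfl⟩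
  · rintro ⟨rfl, (e : isoKPerp A S x), (rfl : cls A S x e = b), he⟩
    obtain ⟨X, β, -, hX, -⟩ := id he
    dsimp only at hX
    -- The given representative may contain a term `p^*β` with `dj_x^*β = 0`; dropping it changes
    -- neither the coordinates nor the class.
    have h1 : HasCoords S nab x (nab.toFun _ (S.dincl x X)) ((Y, 0) : ER × Module.Dual ℝ ER) :=
      ⟨X, 0, by simp, hX, fun _ => rfl⟩
    refine ⟨⟨_, h1.mem_isoKPerp hnab (hv x)⟩, X, ?_, rfl, ?_⟩
    · exact (HasCoords.cls_eq_iff hq hnab (hv x) h1 he).2 rfl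
    · rw [hX]

theorem HasCoords.anchorRed_iff (hq : IsQuotientManifold G EN N ER) (hnab : nab.IsAdmissible A S)
    (hv : ∀ x, IsVerticalSpan ER A S x) {x : N} {e : isoKPerp A S x} {v : ER × Module.Dual ℝ ER}
    (h : HasCoords S nab x (e : E (S.incl x)) v)
    (Y : TangentSpace 𝓘(ℝ, ER) (quot G N x)) :
    AnchorRed A S ⟨x, cls A S x e⟩ ⟨quot G N x, Y⟩ ↔ Y = v.1 := by
  constructor
  · rintro ⟨e', X, h1, h2, h3⟩
    rw [TotalSpace.mk.injEq] at h3
    obtain ⟨v', hv'⟩ := exists_coords_of_mem_isoKPerp (ER := ER) hnab (hv x) e'.2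
    obtain rfl := (hv'.cls_eq_iff hq hnab (hv x) h).1 h1
    obtain ⟨X', β, he, hX, -⟩ := hv'
    rw [he, nab.anchor_add_coanchor] at h2
    obtain rfl : X' = X := S.immersion x h2
    exact (eq_of_heq h3.2).trans hX
  · rintro rfl
    obtain ⟨X, β, he, hX, -⟩ := id h
    refine ⟨e, X, rfl, ?_, ?_⟩
    · rw [he, nab.anchor_add_coanchor]
    · exact congrArg _ hX.symm

theorem coanchorRed_eq_coordSet (hq : IsQuotientManifold G EN N ER)
    (hnab : nab.IsAdmissible A S) (hv : ∀ x, IsVerticalSpan ER A S x) (y : MRed G N)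
    (η : Cotangent (EM := ER) y) :
    coanchorRed A S y η = coordSet A S nab y ((0, η) : ER × Module.Dual ℝ ER) := by
  ext ⟨x, b⟩
  constructor
  · rintro ⟨rfl, h⟩
    obtain ⟨e, rfl⟩ := Submodule.mkQ_surjective _ b
    obtain ⟨v, hve⟩ := exists_coords_of_mem_isoKPerp (ER := ER) hnab (hv x) e.2
    -- Every `w` is the coordinate vector of some class at `x`. Testing on `(0, ζ)` forces `v.1 =
    -- 0`, and testing on `(Y, 0)` forces `v.2 = η`.
    have key : ∀ w : ER × Module.Dual ℝ ER, v.2 w.1 + w.2 v.1 = η w.1 := by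
      intro w
      obtain ⟨e', he', -⟩ := coordSet_nonempty (ER := ER) hq hnab hv x w
      rw [← hve.pairing he']
      exact h (cls A S x e') w.1 ((he'.anchorRed_iff hq hnab hv _).2 rfl)
    refine ⟨rfl, e, rfl, ?_⟩
    have h1 : v = ((0, η) : ER × Module.Dual ℝ ER) := by
      refine Prod.ext ?_ (LinearMap.ext fun Y => ?_)
      · refine (Module.forall_dual_apply_eq_zero_iff ℝ v.1).1 fun ζ => ?_
        have h1 := key (0, ζ)
        rw [map_zero v.2, zero_add] at h1
        exact h1.trans (map_zero η)
      · exact (add_zero _).symm.trans (key (Y, 0))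
    exact h1 ▸ hve
  · rintro ⟨rfl, (e : isoKPerp A S x), (rfl : cls A S x e = b), he⟩
    refine ⟨rfl, fun b Y hY => ?_⟩
    obtain ⟨e', rfl⟩ := Submodule.mkQ_surjective _ b
    obtain ⟨v, hve⟩ := exists_coords_of_mem_isoKPerp (ER := ER) hnab (hv x) e'.2
    obtain rfl := (hve.anchorRed_iff hq hnab hv _).1 hY
    exact (he.pairing hve).trans
      ((congrArg (fun r : ℝ => η v.1 + r) (map_zero v.2)).trans (add_zero _))

theorem splitRed_eq_coordSet (hq : IsQuotientManifold G EN N ER) (hnab : nab.IsAdmissible A S)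
    (hv : ∀ x, IsVerticalSpan ER A S x) (y : MRed G N)
    (v : TangentSpace 𝓘(ℝ, ER) y × Cotangent (EM := ER) y) :
    splitRed A S nab y v = coordSet (ER := ER) A S nab y v := by
  rw [splitRed, nablaRed_eq_coordSet hq hnab hv, coanchorRed_eq_coordSet hq hnab hv,
    addRed_coordSet hq hnab hv]
  congr 1
  exact Prod.ext (add_zero _) (zero_add _)

theorem DiracStructure.IsInvariant.mem_of_onTotal_eq {L : DiracStructure C}
    (hL : L.IsInvariant A) {g : G} {m m' : M} {e : E m} {e' : E m'}
    (h : (⟨m', e'⟩ : TotalSpace F E) = A.onTotal g ⟨m, e⟩) (he : e ∈ L.fibre m) :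
    e' ∈ L.fibre m' := by
  rw [LiftedAction.onTotal, TotalSpace.mk.injEq] at h
  obtain ⟨rfl, h⟩ := h
  rw [eq_of_heq h]
  exact hL g m e he

theorem coordSet_mem_LRed_iff (hq : IsQuotientManifold G EN N ER) (hnab : nab.IsAdmissible A S)
    (hv : ∀ x, IsVerticalSpan ER A S x) {L : DiracStructure C} (hL : L.IsInvariant A) (x : N)
    (v : ER × Module.Dual ℝ ER) :
    coordSet A S nab (quot G N x) v ∈ LRed A S L (quot G N x) ↔
      ∃ e ∈ L.fibre (S.incl x), HasCoords S nab x e v := by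
  constructor
  · rintro ⟨x', e, hx', he, heq⟩
    obtain ⟨w, hw⟩ := exists_coords_of_mem_isoKPerp (ER := ER) hnab (hv x') e.2
    rw [orbitOf_eq_coordSet hq hnab hv hw, hx'] at heq
    obtain rfl := coordSet_injective hq hnab hv x heq
    obtain ⟨l, hl, k, hk, hlk⟩ := Submodule.mem_sup.1 he
    have hk0 := (hasCoords_zero_iff (ER := ER) hnab (hv x')).2 hk
    -- Discarding the `K`-component leaves the coordinates unchanged, so a representative in `L`
    -- remains; invariance of `L` then moves it from `x'` to `x`.
    have hlc : HasCoords S nab x' l v := by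
      have := hw.sub hk0
      rwa [← hlk, add_sub_cancel_right, sub_zero] at this
    obtain ⟨g, rfl⟩ := quot_eq_iff.1 hx'.symm
    obtain ⟨e', he', hc⟩ := hlc.exists_smul hq hnab.1 g
    exact ⟨e', hL.mem_of_onTotal_eq he' hl.1, hc⟩
  · rintro ⟨e, he, hc⟩
    have hp := hc.mem_isoKPerp hnab (hv x)
    exact ⟨x, ⟨e, hp⟩, rfl, Submodule.mem_sup_left ⟨he, hp⟩,
      (orbitOf_eq_coordSet hq hnab hv (e := ⟨e, hp⟩) hc).symm⟩

theorem exists_hasCoords_mem_iff (L : DiracStructure C) (x : N)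
    (Y : TangentSpace 𝓘(ℝ, ER) (quot G N x)) (η : Cotangent (EM := ER) (quot G N x)) :
    (∃ e ∈ L.fibre (S.incl x), HasCoords S nab x e ((Y, η) : ER × Module.Dual ℝ ER)) ↔
      ∃ X : TangentSpace 𝓘(ℝ, EN) x,
        dquot G EN ER x X = Y ∧ (X, η ∘ₗ dquot G EN ER x) ∈ backward S nab L x := by
  constructor
  · rintro ⟨_, he, X, β, rfl, hX, hβ⟩
    exact ⟨X, hX, β, LinearMap.ext fun Z => (hβ Z).symm, he⟩
  · rintro ⟨X, hX, β, hβ, he⟩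
    exact ⟨_, he, X, β, rfl, hX, fun Z => (LinearMap.congr_fun hβ Z).symm⟩

end ReducedBundle

end DiracReduction

theorem proposition2p6
    {EM : Type*} [NormedAddCommGroup EM] [NormedSpace ℝ EM] [FiniteDimensional ℝ EM]
    {M : Type*} [TopologicalSpace M] [T2Space M] [SecondCountableTopology M]
    [ChartedSpace EM M] [IsManifold 𝓘(ℝ, EM) ∞ M]
    {F : Type*} [NormedAddCommGroup F] [NormedSpace ℝ F] [FiniteDimensional ℝ F]
    {E : M → Type*} [TopologicalSpace (TotalSpace F E)] [∀ x, TopologicalSpace (E x)]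
    [∀ x, AddCommGroup (E x)] [∀ x, Module ℝ (E x)] [FiberBundle F E] [VectorBundle ℝ F E]
    [ContMDiffVectorBundle ∞ F E 𝓘(ℝ, EM)]
    (C : ExactCourantAlgebroid EM M F E)
    {EG : Type*} [NormedAddCommGroup EG] [NormedSpace ℝ EG] [FiniteDimensional ℝ EG]
    {G : Type*} [TopologicalSpace G] [T2Space G] [CompactSpace G] [ConnectedSpace G]
    [ChartedSpace EG G] [Group G] [LieGroup 𝓘(ℝ, EG) ∞ G]
    [MulAction G M] [ContMDiffSMul 𝓘(ℝ, EG) 𝓘(ℝ, EM) ∞ G M]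
    (A : LiftedAction C EG G) (hA : A.IsIsotropic)
    {EN : Type*} [NormedAddCommGroup EN] [NormedSpace ℝ EN] [FiniteDimensional ℝ EN]
    {N : Type*} [TopologicalSpace N] [T2Space N] [SecondCountableTopology N]
    [ChartedSpace EN N] [IsManifold 𝓘(ℝ, EN) ∞ N] [MulAction G N]
    (S : FreeInvariantSubmanifold EM M G EG EN N)
    {ER : Type*} [NormedAddCommGroup ER] [NormedSpace ℝ ER] [FiniteDimensional ℝ ER]
    [ChartedSpace ER (MRed G N)] [IsManifold 𝓘(ℝ, ER) ∞ (MRed G N)]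
    (hq : IsQuotientManifold G EN N ER)
    (L : DiracStructure C) (hL : L.IsInvariant A)
    (nab : IsotropicSplitting C) (hnab : nab.IsAdmissible A S) (x : N) :
    (∀ (Y : TangentSpace 𝓘(ℝ, ER) (quot G N x)) (η : Cotangent (EM := ER) (quot G N x)),
      addRed A S (nablaRed A S nab ⟨quot G N x, Y⟩) (coanchorRed A S (quot G N x) η)
          ∈ LRed A S L (quot G N x) ↔
        ∃ X : TangentSpace 𝓘(ℝ, EN) x,
          dquot G EN ER x X = Y ∧ (X, η ∘ₗ dquot G EN ER x) ∈ backward S nab L x) ∧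
    Set.BijOn (splitRed (ER := ER) A S nab (quot G N x)) Set.univ (ERed A S (quot G N x)) ∧
    LRed A S L (quot G N x) =
      splitRed A S nab (quot G N x) '' forward ER x (backward S nab L x) := by
  have hv : ∀ z : N, IsVerticalSpan ER A S z := fun z =>
    ⟨fun u => exists_mem_ker_dquot A S hq L u z, exists_anchor_chi_eq A S hq L z⟩
  have key : ∀ (Y : TangentSpace 𝓘(ℝ, ER) (quot G N x)) (η : Cotangent (EM := ER) (quot G N x)),
      splitRed A S nab (quot G N x) (Y, η) ∈ LRed A S L (quot G N x) ↔
        ∃ X : TangentSpace 𝓘(ℝ, EN) x,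
          dquot G EN ER x X = Y ∧ (X, η ∘ₗ dquot G EN ER x) ∈ backward S nab L x := by
    intro Y η
    rw [splitRed_eq_coordSet hq hnab hv]
    exact (coordSet_mem_LRed_iff hq hnab hv hL x (Y, η)).trans (exists_hasCoords_mem_iff L x Y η)
  have hsurj : Set.SurjOn (splitRed (ER := ER) A S nab (quot G N x)) Set.univ
      (ERed A S (quot G N x)) := by
    rintro _ ⟨⟨x', b⟩, hx', rfl⟩
    obtain ⟨e, rfl⟩ := Submodule.mkQ_surjective _ b
    obtain ⟨v, hve⟩ := exists_coords_of_mem_isoKPerp (ER := ER) hnab (hv x') e.2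
    refine ⟨v, trivial, ?_⟩
    refine (splitRed_eq_coordSet hq hnab hv _ v).trans
      (Eq.trans ?_ (orbitOf_eq_coordSet hq hnab hv hve).symm)
    rw [show quot G N x' = quot G N x from hx']
  refine ⟨key, ⟨?_, ?_, hsurj⟩, ?_⟩
  · intro v _
    obtain ⟨e, he, -⟩ := coordSet_nonempty (ER := ER) hq hnab hv x v
    rw [splitRed_eq_coordSet hq hnab hv]
    exact ⟨_, rfl, (orbitOf_eq_coordSet hq hnab hv he).symm⟩
  · intro v _ w _ h
    rw [splitRed_eq_coordSet hq hnab hv, splitRed_eq_coordSet hq hnab hv] at h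
    exact coordSet_injective hq hnab hv x h
  · ext z
    constructor
    · intro hz
      obtain ⟨x', e, hx', -, hze⟩ := id hz
      -- An element of `L_red` lies in `E_red`, so surjectivity puts it in the form to which `key`
      -- applies.
      obtain ⟨⟨Y, η⟩, -, rfl⟩ := hsurj ⟨⟨x', cls A S x' e⟩, hx', hze⟩
      obtain ⟨X, hX, hb⟩ := (key Y η).1 hz
      exact ⟨(Y, η), ⟨X, hX.symm, hb⟩, rfl⟩
    · rintro ⟨⟨Y, η⟩, ⟨X, hX, hb⟩, rfl⟩
      exact (key Y η).2 ⟨X, hX.symm, hb⟩
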